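/- Work over $\mathbb{C}$. **Cubics containing a plane.** Let $Y\subset\mathbb{P}^5$, with coordinates $x_0,x_1,x_2,y_0,y_1,y_2$, be given by a cubic equation $$F=\sum_{i,j} l_{ij}\,y_iy_j+2\sum_k q_k\,y_k+f ,\qquad l_{ij}=l_{ji},$$ where $l_{ij},q_k,f\in\mathbb{C}[x_0,x_1,x_2]$ are homogeneous of degrees $1,2,3$ (or zero); so $Y$ contains the plane $A=\{x_0=x_1=x_2=0\}$. Let $\bar F\in\mathbb{C}[x_0,\dots,x_3,y_0,y_1,y_2]$ be homogeneous of degree $2$, and let $\bar Y\subset\mathbb{P}^6$ be the cubic with equation $$F+x_3\bar F=\sum_{i,j}\bar l_{ij}\,y_iy_j+2\sum_k\bar q_k\,y_k+\bar f ,\qquad \bar l_{ij}=\bar l_{ji},$$ with $\bar l_{ij},\bar q_k,\bar f\in\mathbb{C}[x_0,\dots,x_3]$ homogeneous of degrees $1,2,3$. Thus $Y=\bar Y\cap\{x_3=0\}$. **Quadratic forms.** Projecting $Y$ from $A$ gives a quadric fibration over $B=\mathbb{P}^2$, defined by the quadratic form $q$ on $\mathscr{E}=\mathscr{O}^{\oplus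 3}\oplus\mathscr{O}(-1)$ with values in $\mathscr{L}=\mathscr{O}(1)$, $$q(s_0,s_1,s_2,t)=\sum_{i,j} l_{ij}s_is_j+2\sum_k q_k s_k t+f\,t^2 .$$ In the same way $(\bar l_{ij},\bar q_k,\bar f)$ defines a quadratic form $\bar q$ on $\mathscr{O}^{\oplus3}\oplus\mathscr{O}(-1)$ over $\bar B=\mathbb{P}^3$ with values in $\mathscr{O}(1)$. The even Clifford algebra of $(\mathscr{E},q,\mathscr{L})$ is the sheaf of $\mathscr{O}$-algebras $$T(\mathscr{E}\otimes\mathscr{E}\otimes\mathscr{L}^*)/(J_1+J_2),$$ where $J_1$ is generated by $v\otimes v\otimes\varphi-\varphi(q(v))$ and $J_2$ by $u\otimes v\otimes\varphi\otimes v\otimes w\otimes\psi-\varphi(q(v))\,u\otimes w\otimes\psi$. Let $\mathscr{B}_0$ on $\mathbb{P}^2$ and $\bar{\mathscr{B}}_0$ on $\mathbb{P}^3$ be the even Clifford algebras of $q$ and $\bar q$. **Noncommutative varieties.** A scheme with a sheaf of algebras is a pair $(X,\mathscr{B})$ of a scheme and a sheaf of (not necessarily commutative) $\mathscr{O}_X$-algebras.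 A morphism $(X_1,\mathscr{B}_1)\to(X_2,\mathscr{B}_2)$ is a morphism of schemes $g\colon X_1\to X_2$ together with a morphism of $\mathscr{O}_{X_1}$-algebras $g^*\mathscr{B}_2\to\mathscr{B}_1$; it is strict if the latter is an isomorphism. A scheme $X$ is identified with $(X,\mathscr{O}_X)$, and there is a canonical morphism $(X,\mathscr{B})\to X$, the identity on $X$. Noncommutative varieties are such pairs with $\mathscr{B}$ of finite rank over $\mathscr{O}_X$. **Statement.** Let $i\colon\mathbb{P}^2=\{x_3=0\}\hookrightarrow\mathbb{P}^3$ be the inclusion. Then $\mathscr{B}_0$ and $\bar{\mathscr{B}}_0$ are locally free of finite rank, and $$(\mathbb{P}^2,\mathscr{B}_0)=(\mathbb{P}^3,\bar{\mathscr{B}}_0)\times_{\mathbb{P}^3}\mathbb{P}^2 .$$ More precisely, there is a strict morphism $p\colon(\mathbb{P}^2,\mathscr{B}_0)\to(\mathbb{P}^3,\bar{\mathscr{B}}_0)$ lying over $i$ (so $i^*\bar{\mathscr{B}}_0\cong\mathscr{B}_0$ as sheaves of algebras) such that the square formed by $p$, by the canonical morphisms $(\mathbb{P}^2,\mathscr{B}_0)\to\mathbb{P}^2$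 and $(\mathbb{P}^3,\bar{\mathscr{B}}_0)\to\mathbb{P}^3$, and by $i$ is cartesian in the category of schemes with a sheaf of algebras. -/

import Mathlib

open CategoryTheory AlgebraicGeometry TopologicalSpace Opposite

noncomputable section

universe u

/-- A sheaf of (not necessarily commutative) `𝒪_X`-algebras on a scheme `X`: a sheaf of rings
together with a morphism from `𝒪_X` with central image. -/
structure AlgebraSheaf (X : Scheme.{u}) where
  /-- the underlying sheaf of rings -/
  sheaf : Sheaf (Opens.grothendieckTopology X) RingCat.{u}
  /-- the structure morphism from `𝒪_X` -/
  structureMap : X.ringCatSheaf ⟶ sheaf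
  central : ∀ (U : X.Opens) (r : Γ(X, U)) (b : sheaf.obj.obj (op U)),
    Commute (structureMap.hom.app (op U) r) b

namespace AlgebraSheaf

variable {X : Scheme.{u}} (B : AlgebraSheaf X)

/-- The ring of sections over an open subset. -/
abbrev Sections (U : X.Opens) : Type u := B.sheaf.obj.obj (op U)

/-- The structure morphism `𝒪_X(U) → B(U)`. -/
def algMap (U : X.Opens) : Γ(X, U) →+* B.Sections U := (B.structureMap.hom.app (op U)).hom

/-- The restriction map `B(V) → B(U)` for `U ≤ V`. -/
def res {U V : X.Opens} (h : U ≤ V) : B.Sections V →+* B.Sections U :=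
  (B.sheaf.obj.map (homOfLE h).op).hom

theorem res_algMap {U V : X.Opens} (h : U ≤ V) (r : Γ(X, V)) :
    B.res h (B.algMap V r) = B.algMap U (X.presheaf.map (homOfLE h).op r) :=
  (ConcreteCategory.congr_hom (B.structureMap.hom.naturality (homOfLE h).op) r).symm

/-- The structure sheaf as a sheaf of algebras over itself. -/
def unit (X : Scheme.{u}) : AlgebraSheaf X where
  sheaf := X.ringCatSheaf
  structureMap := 𝟙 _
  central U r b := mul_comm (G := Γ(X, U)) r b

/-- The underlying `𝒪_X`-module of a sheaf of algebras. -/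
def toModules : X.Modules :=
  (SheafOfModules.restrictScalars B.structureMap).obj (SheafOfModules.unit B.sheaf)

/-- `B` is locally free of finite rank as an `𝒪_X`-module: locally on `X` there are finitely many
sections forming a basis of `B(V)` over `𝒪_X(V)` for all smaller open subsets `V`. -/
def IsLocallyFreeOfFiniteRank : Prop :=
  ∀ x : X, ∃ U : X.Opens, x ∈ U ∧ ∃ (n : ℕ) (s : Fin n → B.Sections U),
    ∀ (V : X.Opens) (h : V ≤ U), Function.Bijective
      (fun c : Fin n → Γ(X, V) => ∑ i, B.algMap V (c i) * B.res h (s i))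

end AlgebraSheaf

/-- A scheme with a sheaf of algebras over its structure sheaf. -/
structure NCScheme where
  /-- the underlying scheme -/
  base : Scheme.{u}
  /-- the sheaf of algebras -/
  alg : AlgebraSheaf base

namespace NCScheme

/-- A morphism `(X, B_X) ⟶ (Y, B_Y)`: a morphism of schemes `f : X ⟶ Y` and a morphism of
`𝒪_Y`-algebras `B_Y ⟶ f_* B_X`, which by adjunction is the same thing as a
morphism of `𝒪_X`-algebras `f^* B_Y ⟶ B_X`. -/
@[ext]
structure Hom (X Y : NCScheme.{u}) where
  /-- the morphism of schemes -/
  base : X.base ⟶ Y.base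
  /-- the morphism of sheaves of rings `B_Y ⟶ f_* B_X` on sections -/
  app (U : Y.base.Opens) : Y.alg.Sections U →+* X.alg.Sections (base ⁻¹ᵁ U)
  app_res : ∀ {U V : Y.base.Opens} (h : U ≤ V) (b : Y.alg.Sections V),
    app U (Y.alg.res h b) = X.alg.res (base.preimage_mono h) (app V b)
  app_algMap : ∀ (U : Y.base.Opens) (r : Γ(Y.base, U)),
    app U (Y.alg.algMap U r) = X.alg.algMap (base ⁻¹ᵁ U) (base.app U r)

instance : Category NCScheme.{u} where
  Hom := Hom
  id X :=
    { base := 𝟙 X.base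
      app := fun _ => RingHom.id _
      app_res := fun _ _ => rfl
      app_algMap := fun _ _ => rfl }
  comp {X Y Z} f g :=
    { base := f.base ≫ g.base
      app := fun U => (f.app (g.base ⁻¹ᵁ U)).comp (g.app U)
      app_res := fun h b =>
        (congrArg (f.app _) (g.app_res h b)).trans
          (f.app_res (g.base.preimage_mono h) (g.app _ b))
      app_algMap := fun U r =>
        (congrArg (f.app (g.base ⁻¹ᵁ U)) (g.app_algMap U r)).trans
          (f.app_algMap (g.base ⁻¹ᵁ U) (g.base.app U r)) }

/-- A scheme `X`, viewed as `(X, 𝒪_X)`. -/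
def ofScheme (X : Scheme.{u}) : NCScheme.{u} := ⟨X, AlgebraSheaf.unit X⟩

/-- A morphism of schemes `f`, viewed as a morphism `(X, 𝒪_X) ⟶ (Y, 𝒪_Y)`. -/
def ofHom {X Y : Scheme.{u}} (f : X ⟶ Y) : ofScheme X ⟶ ofScheme Y where
  base := f
  app U := (f.app U).hom
  app_res h r := ConcreteCategory.congr_hom (f.naturality (homOfLE h).op) r
  app_algMap _ _ := rfl

/-- The canonical morphism `(X, B) ⟶ (X, 𝒪_X)`, the identity on `X`. -/
def toBase (X : NCScheme.{u}) : X ⟶ ofScheme X.base where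
  base := 𝟙 X.base
  app U := X.alg.algMap U
  app_res h r := (X.alg.res_algMap h r).symm
  app_algMap _ _ := rfl

/-- The morphism of `𝒪_Y`-modules `B_Y ⟶ f_* B_X` underlying a morphism. -/
def Hom.moduleMap {X Y : NCScheme.{u}} (f : X.Hom Y) :
    Y.alg.toModules ⟶ (Scheme.Modules.pushforward f.base).obj X.alg.toModules where
  val := PresheafOfModules.homMk
    { app := fun U => AddCommGrpCat.ofHom (f.app U.unop).toAddMonoidHom
      naturality := fun U V i => by
        ext b
        exact f.app_res (leOfHom i.unop) b }
    (fun U r m => (map_mul (f.app U.unop) (Y.alg.algMap U.unop r) m).trans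
      (congrArg (· * f.app U.unop m) (f.app_algMap U.unop r)))

/-- A morphism is strict if the morphism `f^* B_Y ⟶ B_X` adjoint to `B_Y ⟶ f_* B_X` is an
isomorphism. -/
def IsStrict {X Y : NCScheme.{u}} (f : X ⟶ Y) : Prop :=
  IsIso (((Scheme.Modules.pullbackPushforwardAdjunction (Hom.base f)).homEquiv _ _).symm (Hom.moduleMap f))

end NCScheme

namespace EvenClifford

open TensorProduct

variable {X : Scheme.{u}}

/-- Restriction of functions. -/
abbrev resO {U V : X.Opens} (h : U ≤ V) : Γ(X, V) →+* Γ(X, U) :=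
  (X.presheaf.map (homOfLE h).op).hom

/-- Restriction of sections of a module. -/
abbrev resM (M : X.Modules) {U V : X.Opens} (h : U ≤ V) : Γ(M, V) →+ Γ(M, U) :=
  (M.presheaf.map (homOfLE h).op).hom

theorem resO_id (U : X.Opens) (r : Γ(X, U)) : resO le_rfl r = r :=
  ConcreteCategory.congr_hom (X.presheaf.map_id (op U)) r

theorem resO_comp {U V W : X.Opens} (h : U ≤ V) (k : V ≤ W) (r : Γ(X, W)) :
    resO h (resO k r) = resO (h.trans k) r :=
  (ConcreteCategory.congr_hom (X.presheaf.map_comp (homOfLE k).op (homOfLE h).op) r).symm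

theorem resM_id (M : X.Modules) (U : X.Opens) (m : Γ(M, U)) : resM M le_rfl m = m :=
  ConcreteCategory.congr_hom (M.presheaf.map_id (op U)) m

theorem resM_comp (M : X.Modules) {U V W : X.Opens} (h : U ≤ V) (k : V ≤ W) (m : Γ(M, W)) :
    resM M h (resM M k m) = resM M (h.trans k) m :=
  (ConcreteCategory.congr_hom (M.presheaf.map_comp (homOfLE k).op (homOfLE h).op) m).symm

theorem resM_smul (M : X.Modules) {U V : X.Opens} (h : U ≤ V) (r : Γ(X, V)) (m : Γ(M, V)) :
    resM M h (r • m) = resO h r • resM M h m :=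
  Scheme.Modules.map_smul M (homOfLE h) r m

end EvenClifford
open EvenClifford TensorProduct

variable {X : Scheme.{u}}

/-- The sections over `U` of the dual `L^* = Hom(L, 𝒪_X)`: morphisms of `𝒪_U`-modules from
`L|_U` to `𝒪_U`, as compatible families of linear maps on the open subsets of `U`. -/
def DualSections (L : X.Modules) (U : X.Opens) : Type u :=
  { φ : ∀ V : {V : X.Opens // V ≤ U}, Γ(L, V.1) →ₗ[Γ(X, V.1)] Γ(X, V.1) //
    ∀ (V W : X.Opens) (h : V ≤ W) (hW : W ≤ U) (m : Γ(L, W)),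
      φ ⟨V, h.trans hW⟩ (resM L h m) = resO h (φ ⟨W, hW⟩ m) }

namespace DualSections

variable {L : X.Modules} {U : X.Opens}

instance : AddCommGroup (DualSections L U) :=
  inferInstanceAs (AddCommGroup (AddSubgroup.mk (AddSubmonoid.mk (AddSubsemigroup.mk
    { φ : ∀ V : {V : X.Opens // V ≤ U}, Γ(L, V.1) →ₗ[Γ(X, V.1)] Γ(X, V.1) |
      ∀ (V W : X.Opens) (h : V ≤ W) (hW : W ≤ U) (m : Γ(L, W)),
        φ ⟨V, h.trans hW⟩ (resM L h m) = resO h (φ ⟨W, hW⟩ m) }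
    (by
      intro φ ψ hφ hψ V W h hW m
      simp only [Pi.add_apply, LinearMap.add_apply, hφ V W h hW m, hψ V W h hW m, map_add]))
    (by
      intro V W h hW m
      simp only [Pi.zero_apply, LinearMap.zero_apply, map_zero]))
    (by
      intro φ hφ V W h hW m
      simp only [Pi.neg_apply, LinearMap.neg_apply, hφ V W h hW m, map_neg])))

/-- Evaluation of a section of `L^*` over `U` at a section of `L` over `V ≤ U`. -/
def eval (φ : DualSections L U) {V : X.Opens} (h : V ≤ U) : Γ(L, V) →ₗ[Γ(X, V)] Γ(X, V) :=
  φ.1 ⟨V, h⟩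

@[ext]
theorem ext {φ ψ : DualSections L U}
    (H : ∀ (V : X.Opens) (h : V ≤ U) (m : Γ(L, V)), φ.eval h m = ψ.eval h m) : φ = ψ :=
  Subtype.ext (funext fun V => LinearMap.ext fun m => H V.1 V.2 m)

theorem eval_res (φ : DualSections L U) {V W : X.Opens} (h : V ≤ W) (hW : W ≤ U) (m : Γ(L, W)) :
    φ.eval (h.trans hW) (resM L h m) = resO h (φ.eval hW m) :=
  φ.2 V W h hW m

@[simp] theorem eval_add (φ ψ : DualSections L U) {V : X.Opens} (h : V ≤ U) :
    (φ + ψ).eval h = φ.eval h + ψ.eval h := rfl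

@[simp] theorem eval_zero {V : X.Opens} (h : V ≤ U) : (0 : DualSections L U).eval h = 0 := rfl

instance : SMul Γ(X, U) (DualSections L U) where
  smul r φ := ⟨fun V => resO V.2 r • φ.eval V.2, fun V W h hW m => by
    simp only [LinearMap.smul_apply, smul_eq_mul, eval_res φ h hW m, map_mul, resO_comp]⟩

@[simp] theorem eval_smul (r : Γ(X, U)) (φ : DualSections L U) {V : X.Opens} (h : V ≤ U) :
    (r • φ).eval h = resO h r • φ.eval h := rfl

instance : Module Γ(X, U) (DualSections L U) where
  one_smul φ := by ext V h m; simp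
  mul_smul r s φ := by ext V h m; simp [mul_assoc]
  smul_zero r := by ext V h m; simp
  smul_add r φ ψ := by ext V h m; simp
  add_smul r s φ := by ext V h m; simp [add_mul]
  zero_smul φ := by ext V h m; simp

/-- Restriction of sections of `L^*`. -/
def res {U V : X.Opens} (h : U ≤ V) : DualSections L V →+ DualSections L U where
  toFun φ := ⟨fun W => φ.eval (W.2.trans h), fun _ _ k hW m => eval_res φ k (hW.trans h) m⟩
  map_zero' := rfl
  map_add' _ _ := rfl

@[simp] theorem eval_resD {U V W : X.Opens} (h : U ≤ V) (φ : DualSections L V) (k : W ≤ U) :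
    (res h φ).eval k = φ.eval (k.trans h) := rfl

theorem res_smul {U V : X.Opens} (h : U ≤ V) (r : Γ(X, V)) (φ : DualSections L V) :
    res h (r • φ) = resO h r • res h φ := by
  ext W k m; simp [resO_comp]

end DualSections

/-- A quadratic form on the `𝒪_X`-module `E` with values in the `𝒪_X`-module `L`: a morphism of
sheaves `q : E → L` with `q(av) = a²q(v)` whose polar form is `𝒪_X`-bilinear. -/
structure ModuleQuadraticForm (E L : X.Modules) where
  /-- the quadratic map on sections -/
  form (U : X.Opens) : QuadraticMap Γ(X, U) Γ(E, U) Γ(L, U)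
  form_res : ∀ {U V : X.Opens} (h : U ≤ V) (v : Γ(E, V)),
    form U (resM E h v) = resM L h (form V v)

namespace ModuleQuadraticForm

variable {E L : X.Modules} (q : ModuleQuadraticForm E L)

/-- The module `E(U) ⊗ E(U) ⊗ L^*(U)`. -/
abbrev Gen (_q : ModuleQuadraticForm E L) (U : X.Opens) : Type u :=
  Γ(E, U) ⊗[Γ(X, U)] (Γ(E, U) ⊗[Γ(X, U)] DualSections L U)

/-- The defining relations of the even Clifford algebra,
`v ⊗ v ⊗ f = f(q(v))` and `(u ⊗ v ⊗ f) ⊗ (v ⊗ w ⊗ g) = f(q(v)) u ⊗ w ⊗ g`. -/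
inductive Rel (U : X.Opens) :
    TensorAlgebra Γ(X, U) (q.Gen U) → TensorAlgebra Γ(X, U) (q.Gen U) → Prop
  | contract (v : Γ(E, U)) (f : DualSections L U) :
      Rel U (TensorAlgebra.ι _ (v ⊗ₜ (v ⊗ₜ f)))
        (algebraMap _ _ (f.eval le_rfl (q.form U v)))
  | contract_mid (u v w : Γ(E, U)) (f g : DualSections L U) :
      Rel U (TensorAlgebra.ι _ (u ⊗ₜ (v ⊗ₜ f)) * TensorAlgebra.ι _ (v ⊗ₜ (w ⊗ₜ g)))
        (f.eval le_rfl (q.form U v) • TensorAlgebra.ι _ (u ⊗ₜ (w ⊗ₜ g)))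

/-- The algebra `T(E(U) ⊗ E(U) ⊗ L^*(U)) / (J₁ + J₂)` of sections over `U` of the presheaf whose
sheafification is the even Clifford algebra. -/
def PreSections (U : X.Opens) : Type u := RingQuot (q.Rel U)

namespace PreSections

instance (U : X.Opens) : Ring (q.PreSections U) := inferInstanceAs (Ring (RingQuot (q.Rel U)))

instance (U : X.Opens) : Algebra Γ(X, U) (q.PreSections U) :=
  inferInstanceAs (Algebra Γ(X, U) (RingQuot (q.Rel U)))

/-- The quotient map. -/
def mk (U : X.Opens) : TensorAlgebra Γ(X, U) (q.Gen U) →ₐ[Γ(X, U)] q.PreSections U :=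
  RingQuot.mkAlgHom Γ(X, U) (q.Rel U)

/-- The class of `u ⊗ v ⊗ f`. -/
def gen {U : X.Opens} (u v : Γ(E, U)) (f : DualSections L U) : q.PreSections U :=
  mk q U (TensorAlgebra.ι _ (u ⊗ₜ (v ⊗ₜ f)))

variable {q} in
theorem gen_add_left {U : X.Opens} (u u' v : Γ(E, U)) (f : DualSections L U) :
    gen q (u + u') v f = gen q u v f + gen q u' v f := by
  simp only [gen, TensorProduct.add_tmul, map_add]

variable {q} in
theorem gen_add_mid {U : X.Opens} (u v v' : Γ(E, U)) (f : DualSections L U) :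
    gen q u (v + v') f = gen q u v f + gen q u v' f := by
  simp only [gen, TensorProduct.add_tmul, TensorProduct.tmul_add, map_add]

variable {q} in
theorem gen_add_right {U : X.Opens} (u v : Γ(E, U)) (f f' : DualSections L U) :
    gen q u v (f + f') = gen q u v f + gen q u v f' := by
  simp only [gen, TensorProduct.tmul_add, map_add]

variable {q} in
theorem gen_smul_left {U : X.Opens} (r : Γ(X, U)) (u v : Γ(E, U)) (f : DualSections L U) :
    gen q (r • u) v f = r • gen q u v f := by
  simp only [gen, ← TensorProduct.smul_tmul', map_smul]

variable {q} in
theorem gen_smul_mid {U : X.Opens} (r : Γ(X, U)) (u v : Γ(E, U)) (f : DualSections L U) :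
    gen q u (r • v) f = r • gen q u v f := by
  simp only [gen, ← TensorProduct.smul_tmul', TensorProduct.tmul_smul, map_smul]

variable {q} in
theorem gen_smul_right {U : X.Opens} (r : Γ(X, U)) (u v : Γ(E, U)) (f : DualSections L U) :
    gen q u v (r • f) = r • gen q u v f := by
  simp only [gen, TensorProduct.tmul_smul, map_smul]

theorem gen_contract {U : X.Opens} (v : Γ(E, U)) (f : DualSections L U) :
    gen q v v f = algebraMap _ _ (f.eval le_rfl (q.form U v)) :=
  (RingQuot.mkAlgHom_rel Γ(X, U) (Rel.contract v f)).trans (AlgHom.commutes _ _)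

theorem gen_contract_mid {U : X.Opens} (u v w : Γ(E, U)) (f g : DualSections L U) :
    gen q u v f * gen q v w g = f.eval le_rfl (q.form U v) • gen q u w g :=
  (map_mul _ _ _).symm.trans
    ((RingQuot.mkAlgHom_rel Γ(X, U) (Rel.contract_mid u v w f g)).trans (map_smul _ _ _))

variable {q} in
theorem ringHom_ext {U : X.Opens} {A : Type*} [Ring A] {φ ψ : q.PreSections U →+* A}
    (h₁ : ∀ r : Γ(X, U), φ (algebraMap _ _ r) = ψ (algebraMap _ _ r))
    (h₂ : ∀ u v f, φ (gen q u v f) = ψ (gen q u v f)) : φ = ψ := by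
  ext x
  obtain ⟨x, rfl⟩ : ∃ y, mk q U y = x := RingQuot.mkAlgHom_surjective Γ(X, U) (q.Rel U) x
  induction x using TensorAlgebra.induction with
  | algebraMap r => simpa only [AlgHom.commutes] using h₁ r
  | ι x =>
    induction x using TensorProduct.induction_on with
    | zero => simp only [map_zero]
    | add x y hx hy => simp only [map_add, hx, hy]
    | tmul u y =>
      induction y using TensorProduct.induction_on with
      | zero => simp only [TensorProduct.tmul_zero, map_zero]
      | add x y hx hy => simp only [TensorProduct.tmul_add, map_add, hx, hy]
      | tmul v f => exact h₂ u v f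
  | mul x y hx hy => simp only [map_mul, hx, hy]
  | add x y hx hy => simp only [map_add, hx, hy]

variable {q} in
/-- The restriction map, determined by `r ↦ r|_U` and `u ⊗ v ⊗ f ↦ u|_U ⊗ v|_U ⊗ f|_U`. -/
def res {U V : X.Opens} (h : U ≤ V) : q.PreSections V →+* q.PreSections U :=
  letI : Algebra Γ(X, V) (q.PreSections U) := Algebra.compHom _ (resO h)
  (RingQuot.liftAlgHom Γ(X, V) (s := q.Rel V)
    ⟨TensorAlgebra.lift Γ(X, V) (TensorProduct.lift
      { toFun := fun u => TensorProduct.lift (LinearMap.mk₂ Γ(X, V)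
          (fun v f => gen q (resM E h u) (resM E h v) (DualSections.res h f))
          (fun v v' f => by rw [map_add, gen_add_mid])
          (fun r v f => by rw [resM_smul, gen_smul_mid]; rfl)
          (fun v f f' => by rw [map_add, gen_add_right])
          (fun r v f => by rw [DualSections.res_smul, gen_smul_right]; rfl))
        map_add' := fun u u' => by
          ext v f
          simp [gen_add_left]
        map_smul' := fun r u => by
          ext v f
          simp only [TensorProduct.AlgebraTensorModule.curry_apply, TensorProduct.curry_apply,
            LinearMap.restrictScalars_self, TensorProduct.lift.tmul, LinearMap.mk₂_apply,
            RingHom.id_apply, LinearMap.smul_apply, resM_smul, gen_smul_left]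
          rfl }), by
      intro x y hxy
      induction hxy with
      | contract v f =>
        simp only [TensorAlgebra.lift_ι_apply, TensorProduct.lift.tmul, LinearMap.coe_mk,
          AddHom.coe_mk, LinearMap.mk₂_apply, AlgHom.commutes, gen_contract, q.form_res,
          DualSections.eval_resD]
        refine congrArg (algebraMap Γ(X, U) (q.PreSections U)) (f.eval_res h le_rfl _)
      | contract_mid u v w f g =>
        simp only [TensorAlgebra.lift_ι_apply, TensorProduct.lift.tmul, LinearMap.coe_mk,
          AddHom.coe_mk, LinearMap.mk₂_apply, map_mul, map_smul, gen_contract_mid, q.form_res,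
          DualSections.eval_resD]
        exact congrArg (· • gen q _ _ _) (f.eval_res h le_rfl _)⟩).toRingHom

theorem res_algebraMap {U V : X.Opens} (h : U ≤ V) (r : Γ(X, V)) :
    res h (algebraMap _ (q.PreSections V) r) = algebraMap _ _ (resO h r) :=
  letI : Algebra Γ(X, V) (q.PreSections U) := Algebra.compHom _ (resO h)
  AlgHom.commutes (RingQuot.liftAlgHom Γ(X, V) (s := q.Rel V) _) r

theorem res_gen {U V : X.Opens} (h : U ≤ V) (u v : Γ(E, V)) (f : DualSections L V) :
    res h (gen q u v f) = gen q (resM E h u) (resM E h v) (DualSections.res h f) := by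
  let _ : Algebra Γ(X, V) (q.PreSections U) := Algebra.compHom _ (resO h)
  refine (RingQuot.liftAlgHom_mkAlgHom_apply Γ(X, V) _ _ _).trans ?_
  simp

end PreSections

open PreSections

/-- The presheaf of rings `U ↦ T(E(U) ⊗ E(U) ⊗ L^*(U)) / (J₁ + J₂)`. -/
def prePresheaf : (Opens X)ᵒᵖ ⥤ RingCat.{u} where
  obj U := RingCat.of (q.PreSections U.unop)
  map i := RingCat.ofHom (res (leOfHom i.unop))
  map_id U := by
    refine RingCat.hom_ext (ringHom_ext (fun r => ?_) fun u v f => ?_)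
    · exact (res_algebraMap q _ r).trans (congrArg _ (resO_id _ r))
    · refine (res_gen q _ u v f).trans ?_
      rw [resM_id, resM_id]
      rfl
  map_comp {U V W} i j := by
    refine RingCat.hom_ext (ringHom_ext (fun r => ?_) fun u v f => ?_)
    · refine (res_algebraMap q _ r).trans (Eq.symm ?_)
      refine (congrArg (res (leOfHom j.unop)) (res_algebraMap q (leOfHom i.unop) r)).trans ?_
      refine (res_algebraMap q _ _).trans (congrArg _ ?_)
      exact resO_comp _ _ r
    · refine (res_gen q _ u v f).trans (Eq.symm ?_)
      refine (congrArg (res (leOfHom j.unop)) (res_gen q (leOfHom i.unop) u v f)).trans ?_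
      refine (res_gen q _ _ _ _).trans ?_
      rw [resM_comp, resM_comp]
      rfl

/-- The structure morphism from `𝒪_X`. -/
def preStructureMap : X.ringCatSheaf.obj ⟶ q.prePresheaf where
  app U := RingCat.ofHom (algebraMap Γ(X, U.unop) (q.PreSections U.unop))
  naturality U V i := by
    ext r
    exact (res_algebraMap q (leOfHom i.unop) r).symm

theorem commute_of_locally {P : (Opens X)ᵒᵖ ⥤ RingCat.{u}}
    (S : Sheaf (Opens.grothendieckTopology X) RingCat.{u}) (t : P ⟶ S.obj)
    [Presheaf.IsLocallySurjective (Opens.grothendieckTopology X) t] {U : X.Opens}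
    (c b : S.obj.obj (op U))
    (H : ∀ (V : X.Opens) (i : V ⟶ U) (a : P.obj (op V)),
      Commute ((S.obj.map i.op).hom c) ((t.app (op V)).hom a)) : Commute c b := by
  have hS := (Presheaf.isSheaf_iff_isSheaf_forget (Opens.grothendieckTopology X) _
    (forget RingCat.{u})).1 S.property
  refine (((isSheaf_iff_isSheaf_of_type _ _).1 hS).isSeparated _
    (Presheaf.imageSieve_mem (Opens.grothendieckTopology X) t b)).ext ?_
  rintro V i ⟨a, ha⟩
  have h : Commute ((S.obj.map i.op).hom c) ((S.obj.map i.op).hom b) := ha ▸ H V i a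
  exact (map_mul (S.obj.map i.op).hom _ _).trans
    (h.eq.trans (map_mul (S.obj.map i.op).hom _ _).symm)

/-- The even Clifford algebra of a quadratic form: the sheaf of `𝒪_X`-algebras
`T(E ⊗ E ⊗ L^*) / (J₁ + J₂)`. -/
def evenClifford : AlgebraSheaf X where
  sheaf := (presheafToSheaf (Opens.grothendieckTopology X) RingCat.{u}).obj q.prePresheaf
  structureMap := ⟨q.preStructureMap ≫ toSheafify _ q.prePresheaf⟩
  central U r b := by
    refine commute_of_locally _ (toSheafify _ q.prePresheaf) _ b fun V i a => ?_
    have h : (((presheafToSheaf (Opens.grothendieckTopology X) RingCat.{u}).obj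
        q.prePresheaf).obj.map i.op).hom (((toSheafify (Opens.grothendieckTopology X)
          q.prePresheaf).app (op U)).hom (algebraMap Γ(X, U) (q.PreSections U) r)) =
        ((toSheafify (Opens.grothendieckTopology X) q.prePresheaf).app (op V)).hom
          (algebraMap Γ(X, V) (q.PreSections V) (resO (leOfHom i) r)) :=
      (ConcreteCategory.congr_hom ((toSheafify (Opens.grothendieckTopology X)
        q.prePresheaf).naturality i.op) (algebraMap Γ(X, U) (q.PreSections U) r)).symm.trans
        (congrArg ((toSheafify (Opens.grothendieckTopology X) q.prePresheaf).app (op V)).hom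
          (res_algebraMap q (leOfHom i) r))
    refine (congrArg (fun z => Commute z _) h).mpr ?_
    have hc : Commute (algebraMap Γ(X, V) (q.PreSections V) (resO (leOfHom i) r))
        (show q.PreSections V from a) := Algebra.commutes _ _
    exact hc.map ((toSheafify (Opens.grothendieckTopology X) q.prePresheaf).app (op V)).hom

end ModuleQuadraticForm

/-! ### Projective space and the sheaves `𝒪(d)` -/

/-- The polynomial ring `ℂ[x₀, …, xₙ]`. -/
abbrev PolyRing (n : ℕ) : Type := MvPolynomial (Fin (n + 1)) ℂ

/-- The grading of `ℂ[x₀, …, xₙ]` by degree. -/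
abbrev polyGrading (n : ℕ) : ℕ → Submodule ℂ (PolyRing n) :=
  MvPolynomial.homogeneousSubmodule (Fin (n + 1)) ℂ

instance polyGradedRing (n : ℕ) : GradedRing (polyGrading n) := MvPolynomial.gradedAlgebra

/-- Complex projective space `ℙⁿ = Proj ℂ[x₀, …, xₙ]`. -/
abbrev PSpace (n : ℕ) : Scheme.{0} := Proj (polyGrading n)

/-- The homogeneous prime ideal of a point of `ℙⁿ`. -/
abbrev ptIdeal {n : ℕ} (x : PSpace n) : Ideal (PolyRing n) :=
  (ProjectiveSpectrum.asHomogeneousIdeal (𝒜 := polyGrading n) x).toIdeal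

instance isPrime_ptIdeal {n : ℕ} (x : PSpace n) : (ptIdeal x).IsPrime :=
  ProjectiveSpectrum.isPrime (𝒜 := polyGrading n) x

/-- The localization of `ℂ[x₀, …, xₙ]` at the homogeneous prime ideal of a point of `ℙⁿ`. -/
abbrev LocAt {n : ℕ} (x : PSpace n) : Type := Localization.AtPrime (ptIdeal x)

/-- The value of a polynomial in the localization. -/
abbrev polyAt {n : ℕ} (x : PSpace n) : PolyRing n →+* LocAt x := algebraMap _ _

/-- A family of elements of the local rings is a section of `𝒪(d)` if it is locally of the form
`a / b` with `a` and `b` homogeneous polynomials, `deg a = deg b + d`. -/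
def IsTwistSection {n : ℕ} (d : ℤ) {U : (PSpace n).Opens} (s : ∀ x : U, LocAt x.1) : Prop :=
  ∀ x : U, ∃ V : (PSpace n).Opens, x.1 ∈ V ∧ ∃ h : V ≤ U, ∃ (i j : ℕ) (a b : PolyRing n),
    (i : ℤ) = j + d ∧ a.IsHomogeneous i ∧ b.IsHomogeneous j ∧
    ∀ y : V, b ∉ ptIdeal y.1 ∧
      s ⟨y.1, h y.2⟩ * polyAt y.1 b = polyAt y.1 a

namespace IsTwistSection

variable {n : ℕ} {d e : ℤ} {U : (PSpace n).Opens} {s t : ∀ x : U, LocAt x.1}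

theorem notMem_mul {x : PSpace n} {a b : PolyRing n}
    (ha : a ∉ ptIdeal x)
    (hb : b ∉ ptIdeal x) :
    a * b ∉ ptIdeal x :=
  fun h => ((isPrime_ptIdeal x).mem_or_mem h).elim ha hb

theorem zero : IsTwistSection d (0 : ∀ x : U, LocAt x.1) := fun x => by
  obtain ⟨m, hm, f, hf, hfx⟩ : ∃ m, 0 < m ∧ ∃ f ∈ polyGrading n m, f ∉ ptIdeal x.1 := by
    by_contra! H
    exact ProjectiveSpectrum.not_irrelevant_le (𝒜 := polyGrading n) x.1
      ((HomogeneousIdeal.toIdeal_irrelevant_le _).2 fun i hi a ha => H i hi a ha)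
  have hle : d.natAbs ≤ m * d.natAbs := Nat.le_mul_of_pos_left _ hm
  refine ⟨U ⊓ Proj.basicOpen (polyGrading n) f, ⟨x.2, hfx⟩, inf_le_left,
    ((m * d.natAbs : ℕ) + d).toNat, m * d.natAbs, 0, f ^ d.natAbs, by omega,
    MvPolynomial.isHomogeneous_zero _ _ _, MvPolynomial.IsHomogeneous.pow hf _,
    fun y => ⟨?_, by simp⟩⟩
  exact fun hy => y.2.2 ((isPrime_ptIdeal y.1).mem_of_pow_mem _ hy)

theorem add (hs : IsTwistSection d s) (ht : IsTwistSection d t) : IsTwistSection d (s + t) :=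
  fun x => by
  obtain ⟨V, hxV, hV, i, j, a, b, hij, ha, hb, H⟩ := hs x
  obtain ⟨V', hxV', hV', i', j', a', b', hij', ha', hb', H'⟩ := ht x
  refine ⟨V ⊓ V', ⟨hxV, hxV'⟩, inf_le_left.trans hV, i + j', j + j', a * b' + b * a', b * b',
    by push_cast; omega, (ha.mul hb').add ?_, hb.mul hb', fun y => ?_⟩
  · have : i + j' = j + i' := by omega
    exact this ▸ hb.mul ha'
  · obtain ⟨h₁, h₂⟩ := H ⟨y.1, y.2.1⟩
    obtain ⟨h₁', h₂'⟩ := H' ⟨y.1, y.2.2⟩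
    refine ⟨notMem_mul h₁ h₁', ?_⟩
    simp only [Pi.add_apply, map_add, map_mul, ← h₂, ← h₂']
    ring

theorem neg (hs : IsTwistSection d s) : IsTwistSection d (-s) := fun x => by
  obtain ⟨V, hxV, hV, i, j, a, b, hij, ha, hb, H⟩ := hs x
  refine ⟨V, hxV, hV, i, j, -a, b, hij, ha.neg, hb, fun y => ⟨(H y).1, ?_⟩⟩
  simp only [Pi.neg_apply, map_neg, ← (H y).2]
  ring

theorem mul (hs : IsTwistSection d s) (ht : IsTwistSection e t) :
    IsTwistSection (d + e) (s * t) := fun x => by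
  obtain ⟨V, hxV, hV, i, j, a, b, hij, ha, hb, H⟩ := hs x
  obtain ⟨V', hxV', hV', i', j', a', b', hij', ha', hb', H'⟩ := ht x
  refine ⟨V ⊓ V', ⟨hxV, hxV'⟩, inf_le_left.trans hV, i + i', j + j', a * a', b * b',
    by push_cast; omega, ha.mul ha', hb.mul hb', fun y => ?_⟩
  obtain ⟨h₁, h₂⟩ := H ⟨y.1, y.2.1⟩
  obtain ⟨h₁', h₂'⟩ := H' ⟨y.1, y.2.2⟩
  refine ⟨notMem_mul h₁ h₁', ?_⟩
  simp only [Pi.mul_apply, map_mul, ← h₂, ← h₂']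
  ring

theorem one_notMem (x : PSpace n) : (1 : PolyRing n) ∉ ptIdeal x :=
  fun h => (isPrime_ptIdeal x).ne_top ((Ideal.eq_top_iff_one _).2 h)

theorem poly {m : ℕ} {p : PolyRing n} (hp : p.IsHomogeneous m) :
    IsTwistSection (m : ℤ) (fun x : U => polyAt x.1 p) := fun x =>
  ⟨U, x.2, le_rfl, m, 0, p, 1, by simp, hp, MvPolynomial.isHomogeneous_one _ _,
    fun y => ⟨one_notMem y.1, by simp⟩⟩

/-- Regular functions are sections of `𝒪(0)`. -/
theorem ofFunction (r : Γ(PSpace n, U)) : IsTwistSection 0 (fun x : U => (r.1 x).val) :=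
  fun x => by
  obtain ⟨V, hxV, i, m, a, b, hb, H⟩ := r.2 x
  refine ⟨V, hxV, leOfHom i, m, m, a, b, by simp, a.2, b.2, fun y => ⟨hb y, ?_⟩⟩
  have := congrArg HomogeneousLocalization.val (H y)
  refine (congrArg (· * polyAt y.1 b.1) this).trans ?_
  rw [HomogeneousLocalization.val_mk, Localization.mk_eq_mk']
  exact IsLocalization.mk'_spec (LocAt y.1) a.1 _

end IsTwistSection

/-- The sections of `𝒪(d)` as a local predicate. -/
def twistPredicate (n : ℕ) (d : ℤ) :
    TopCat.LocalPredicate (X := (PSpace n).toTopCat) (fun x => LocAt x) where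
  pred {U} s := IsTwistSection (U := U) d s
  res {U V} i s hs x := by
    obtain ⟨W, hxW, hW, k, j, a, b, hkj, ha, hb, H⟩ := hs ⟨x.1, leOfHom i x.2⟩
    exact ⟨W ⊓ U, ⟨hxW, x.2⟩, inf_le_right, k, j, a, b, hkj, ha, hb,
      fun y => H ⟨y.1, y.2.1⟩⟩
  locality {U} s hs x := by
    obtain ⟨V, hxV, i, H⟩ := hs x
    obtain ⟨W, hxW, hW, k, j, a, b, hkj, ha, hb, H⟩ := H ⟨x.1, hxV⟩
    exact ⟨W, hxW, hW.trans (leOfHom i), k, j, a, b, hkj, ha, hb, H⟩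

/-- The sections of `𝒪(d)` over `U`. -/
def twistSections {n : ℕ} (d : ℤ) (U : (PSpace n).Opens) : AddSubgroup (∀ x : U, LocAt x.1) where
  carrier := { s | IsTwistSection d s }
  zero_mem' := IsTwistSection.zero
  add_mem' := IsTwistSection.add
  neg_mem' := IsTwistSection.neg

namespace twistSections

variable {n : ℕ} {d : ℤ}

@[ext]
theorem ext {U : (PSpace n).Opens} {s t : twistSections d U} (h : ∀ x, s.1 x = t.1 x) : s = t :=
  Subtype.ext (funext h)

instance (U : (PSpace n).Opens) : SMul Γ(PSpace n, U) (twistSections d U) where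
  smul r s := ⟨fun x => (r.1 x).val * s.1 x, by
    have := (IsTwistSection.ofFunction r).mul s.2
    rwa [zero_add] at this⟩

theorem smul_apply {U : (PSpace n).Opens} (r : Γ(PSpace n, U)) (s : twistSections d U) (x : U) :
    (r • s).1 x = (r.1 x).val * s.1 x := rfl

instance (U : (PSpace n).Opens) : Module Γ(PSpace n, U) (twistSections d U) where
  one_smul s := by
    ext x
    exact (congrArg (· * s.1 x) (HomogeneousLocalization.val_one)).trans (one_mul _)
  mul_smul r r' s := by
    ext x
    exact (congrArg (· * s.1 x) (HomogeneousLocalization.val_mul _ _)).trans (mul_assoc _ _ _)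
  smul_zero r := by
    ext x
    exact mul_zero _
  smul_add r s t := by
    ext x
    exact mul_add _ _ _
  add_smul r r' s := by
    ext x
    exact (congrArg (· * s.1 x) (HomogeneousLocalization.val_add _ _)).trans (add_mul _ _ _)
  zero_smul s := by
    ext x
    exact (congrArg (· * s.1 x) (HomogeneousLocalization.val_zero)).trans (zero_mul _)

/-- Restriction of sections of `𝒪(d)`. -/
def res {U V : (PSpace n).Opens} (h : U ≤ V) : twistSections d V →+ twistSections d U where
  toFun s := ⟨fun x => s.1 ⟨x.1, h x.2⟩, (twistPredicate n d).res (homOfLE h) s.1 s.2⟩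
  map_zero' := rfl
  map_add' _ _ := rfl

end twistSections

/-- The presheaf of abelian groups underlying `𝒪(d)`. -/
def twistPresheaf (n : ℕ) (d : ℤ) : (Opens (PSpace n))ᵒᵖ ⥤ Ab.{0} where
  obj U := AddCommGrpCat.of (twistSections d U.unop)
  map i := AddCommGrpCat.ofHom (twistSections.res (leOfHom i.unop))

/-- The sheaf of modules `𝒪(d)` on `ℙⁿ`. -/
def twist (n : ℕ) (d : ℤ) : (PSpace n).Modules where
  val :=
    letI (U : (Opens (PSpace n))ᵒᵖ) : Module ((PSpace n).ringCatSheaf.obj.obj U)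
        ((twistPresheaf n d).obj U) :=
      inferInstanceAs (Module Γ(PSpace n, U.unop) (twistSections d U.unop))
    PresheafOfModules.ofPresheaf (R := (PSpace n).ringCatSheaf.obj) (twistPresheaf n d)
      (fun U V i r s => rfl)
  isSheaf := by
    refine (TopCat.Presheaf.isSheaf_iff_isSheaf_comp (forget Ab.{0})
      (X := (PSpace n).toTopCat) (twistPresheaf n d)).2 ?_
    exact TopCat.Presheaf.isSheaf_of_iso (NatIso.ofComponents (fun _ => Iso.refl _) (by cat_disch))
      (TopCat.subsheafToTypes (twistPredicate n d)).property

/-! ### Quadratic forms given by symmetric matrices of polynomials -/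

/-- A morphism of modules on sections, as a linear map. -/
def appLin {X : Scheme.{u}} {M N : X.Modules} (φ : M ⟶ N) (U : X.Opens) :
    Γ(M, U) →ₗ[Γ(X, U)] Γ(N, U) where
  toFun := φ.app U
  map_add' := map_add (φ.app U).hom
  map_smul' := φ.app_smul

theorem appLin_res {X : Scheme.{u}} {M N : X.Modules} (φ : M ⟶ N) {U V : X.Opens} (h : U ≤ V)
    (m : Γ(M, V)) : appLin φ U (resM M h m) = resM N h (appLin φ V m) :=
  ConcreteCategory.congr_hom (φ.mapPresheaf.naturality (homOfLE h).op) m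

/-- A section of `𝒪(d)` as a family of elements of the local rings. -/
def twistVal {n : ℕ} {d : ℤ} {U : (PSpace n).Opens} (s : Γ(twist n d, U)) (x : U) : LocAt x.1 :=
  (show twistSections d U from s).1 x

theorem twistVal_mem {n : ℕ} {d : ℤ} {U : (PSpace n).Opens} (s : Γ(twist n d, U)) :
    IsTwistSection d (twistVal s) :=
  (show twistSections d U from s).2

/-- The section of `𝒪(d)` with given values. -/
def twistMk {n : ℕ} {d : ℤ} {U : (PSpace n).Opens} (s : ∀ x : U, LocAt x.1)
    (hs : IsTwistSection d s) : Γ(twist n d, U) :=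
  (⟨s, hs⟩ : twistSections d U)

theorem twist_ext {n : ℕ} {d : ℤ} {U : (PSpace n).Opens} {s t : Γ(twist n d, U)}
    (h : ∀ x, twistVal s x = twistVal t x) : s = t :=
  twistSections.ext h

theorem twistVal_add {n : ℕ} {d : ℤ} {U : (PSpace n).Opens} (s t : Γ(twist n d, U)) (x : U) :
    twistVal (s + t) x = twistVal s x + twistVal t x := rfl

theorem twistVal_smul {n : ℕ} {d : ℤ} {U : (PSpace n).Opens} (r : Γ(PSpace n, U))
    (s : Γ(twist n d, U)) (x : U) : twistVal (r • s) x = (r.1 x).val * twistVal s x := rfl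

/-- For `p` homogeneous of degree `m` and `m + d + e = c`, the bilinear map
`𝒪(d)(U) × 𝒪(e)(U) → 𝒪(c)(U)`, `(s, t) ↦ p s t`. -/
def polyMul {n : ℕ} {m : ℕ} {d e c : ℤ} (p : PolyRing n) (hp : p.IsHomogeneous m)
    (h : m + d + e = c) (U : (PSpace n).Opens) :
    Γ(twist n d, U) →ₗ[Γ(PSpace n, U)] Γ(twist n e, U) →ₗ[Γ(PSpace n, U)] Γ(twist n c, U) :=
  LinearMap.mk₂ _
    (fun s t => twistMk (fun x => polyAt x.1 p * twistVal s x * twistVal t x)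
      (h ▸ ((IsTwistSection.poly hp).mul (twistVal_mem s)).mul (twistVal_mem t)))
    (fun s s' t => twist_ext fun x =>
      show polyAt x.1 p * (twistVal s x + twistVal s' x) * twistVal t x =
        polyAt x.1 p * twistVal s x * twistVal t x + polyAt x.1 p * twistVal s' x * twistVal t x by
      ring)
    (fun r s t => twist_ext fun x =>
      show polyAt x.1 p * ((r.1 x).val * twistVal s x) * twistVal t x =
        (r.1 x).val * (polyAt x.1 p * twistVal s x * twistVal t x) by ring)
    (fun s t t' => twist_ext fun x =>
      show polyAt x.1 p * twistVal s x * (twistVal t x + twistVal t' x) =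
        polyAt x.1 p * twistVal s x * twistVal t x + polyAt x.1 p * twistVal s x * twistVal t' x by
      ring)
    (fun r s t => twist_ext fun x =>
      show polyAt x.1 p * twistVal s x * ((r.1 x).val * twistVal t x) =
        (r.1 x).val * (polyAt x.1 p * twistVal s x * twistVal t x) by ring)

theorem polyMul_res {n : ℕ} {m : ℕ} {d e c : ℤ} (p : PolyRing n) (hp : p.IsHomogeneous m)
    (h : m + d + e = c) {U V : (PSpace n).Opens} (hUV : U ≤ V) (s : Γ(twist n d, V))
    (t : Γ(twist n e, V)) :
    polyMul p hp h U (resM _ hUV s) (resM _ hUV t) = resM _ hUV (polyMul p hp h V s t) := rfl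

instance (X : Scheme.{u}) : Limits.HasFiniteBiproducts X.Modules :=
  Abelian.hasFiniteBiproducts

/-- The vector bundle `⨁ₖ 𝒪(-wₖ)` on `ℙⁿ`. -/
def splitBundle (n : ℕ) {ι : Type} [Finite ι] (w : ι → ℕ) : (PSpace n).Modules :=
  ⨁ fun k => twist n (-(w k : ℤ))

theorem weight_sum (i j : ℕ) : ((i + j + 1 : ℕ) : ℤ) + -(i : ℤ) + -(j : ℤ) = 1 := by
  push_cast
  ring

/-- The quadratic form `s ↦ ∑ M_{kl} s_k s_l` on `⨁ₖ 𝒪(-wₖ)` with values in `𝒪(1)`, for a matrix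
`M` whose entry `M_{kl}` is homogeneous of degree `w_k + w_l + 1`. -/
def matrixForm {n : ℕ} {ι : Type} [Fintype ι] (w : ι → ℕ) (M : Matrix ι ι (PolyRing n))
    (hM : ∀ k l, (M k l).IsHomogeneous (w k + w l + 1)) :
    ModuleQuadraticForm (splitBundle n w) (twist n 1) where
  form U := LinearMap.BilinMap.toQuadraticMap (∑ k, ∑ l,
    (polyMul (d := -(w k : ℤ)) (e := -(w l : ℤ)) (c := 1) (M k l) (hM k l)
      (weight_sum _ _) U).compl₁₂
      (appLin (Limits.biproduct.π (fun k => twist n (-(w k : ℤ))) k) U)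
      (appLin (Limits.biproduct.π (fun k => twist n (-(w k : ℤ))) l) U))
  form_res {U V} h v := by
    simp only [LinearMap.BilinMap.toQuadraticMap_apply, LinearMap.sum_apply, map_sum]
    refine Finset.sum_congr rfl fun k _ => Finset.sum_congr rfl fun l _ => ?_
    refine (congrArg₂ (fun s t => polyMul (M k l) (hM k l) (weight_sum _ _) U s t)
      (appLin_res _ h v) (appLin_res _ h v)).trans ?_
    exact polyMul_res (M k l) (hM k l) (weight_sum _ _) h _ _

/-! ### Cubic hypersurfaces containing a linear subspace -/

/-- The data `(l_{ij}), (q_k), f` of the equation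
`∑ l_{ij} y_i y_j + 2 ∑ q_k y_k + f` of a cubic hypersurface in
`ℙ^{a+b+1}(x_0 : … : x_b : y_0 : … : y_a)` containing the linear subspace
`A = {x_0 = … = x_b = 0}`: polynomials in `x_0, …, x_b` of degrees one, two and three with
`l_{ij} = l_{ji}`. -/
structure CubicData (b a : ℕ) where
  /-- the coefficients `l_{ij}` of `y_i y_j` -/
  l : Fin (a + 1) → Fin (a + 1) → PolyRing b
  /-- the coefficients `q_k` of `2 y_k` -/
  q : Fin (a + 1) → PolyRing b
  /-- the part of the equation not involving `y` -/
  f : PolyRing b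
  l_symm : ∀ i j, l i j = l j i
  l_homogeneous : ∀ i j, (l i j).IsHomogeneous 1
  q_homogeneous : ∀ k, (q k).IsHomogeneous 2
  f_homogeneous : f.IsHomogeneous 3

namespace CubicData

variable {b a : ℕ} (D : CubicData b a)

/-- The equation of the cubic hypersurface; the variables are `x_i = X (Sum.inl i)` and
`y_j = X (Sum.inr j)`. -/
def equation : MvPolynomial (Fin (b + 1) ⊕ Fin (a + 1)) ℂ :=
  (∑ i, ∑ j, MvPolynomial.rename Sum.inl (D.l i j) *
      (MvPolynomial.X (Sum.inr i) * MvPolynomial.X (Sum.inr j))) +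
    2 * (∑ k, MvPolynomial.rename Sum.inl (D.q k) * MvPolynomial.X (Sum.inr k)) +
    MvPolynomial.rename Sum.inl D.f

/-- The symmetric matrix with blocks `(l_{ij})`, `(q_k)`, `(q_k)ᵀ`, `f`. -/
def matrix : Matrix (Fin (a + 1) ⊕ Unit) (Fin (a + 1) ⊕ Unit) (PolyRing b) :=
  Matrix.fromBlocks (Matrix.of D.l) (Matrix.of fun k _ => D.q k) (Matrix.of fun _ k => D.q k)
    (Matrix.of fun _ _ => D.f)

/-- The weights of the bundle `𝒪^{a+1} ⊕ 𝒪(-1)`. -/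
def weight (a : ℕ) : Fin (a + 1) ⊕ Unit → ℕ := Sum.elim (fun _ => 0) (fun _ => 1)

theorem matrix_homogeneous (k l : Fin (a + 1) ⊕ Unit) :
    (D.matrix k l).IsHomogeneous (weight a k + weight a l + 1) := by
  rcases k with k | k <;> rcases l with l | l
  exacts [D.l_homogeneous k l, D.q_homogeneous k, D.q_homogeneous l, D.f_homogeneous]

/-- The quadratic form `(A₀ ⊗ 𝒪 ⊕ 𝒪(-1), q, 𝒪(1))` on `ℙᵇ` of the quadric fibration obtained by
projecting the cubic hypersurface from `A`:
`q(s, t) = ∑ l_{ij} s_i s_j + 2 ∑ q_k s_k t + f t²`. -/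
def quadraticForm : ModuleQuadraticForm (splitBundle b (weight a)) (twist b 1) :=
  matrixForm (weight a) D.matrix D.matrix_homogeneous

/-- The noncommutative variety `(ℙᵇ, B₀)`, where `B₀` is the even Clifford algebra of the quadric
fibration obtained by projecting the cubic hypersurface from `A`. -/
def ncSpace : NCScheme.{0} := ⟨PSpace b, D.quadraticForm.evenClifford⟩

end CubicData

/-! ### The hyperplane inclusion -/

/-- The graded ring homomorphism `ℂ[x₀, …, xₙ₊₁] → ℂ[x₀, …, xₙ]` with `xₙ₊₁ ↦ 0`. -/
def killLast (n : ℕ) : polyGrading (n + 1) →+*ᵍ polyGrading n where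
  __ := (MvPolynomial.aeval (R := ℂ)
    (Fin.snoc (α := fun _ => PolyRing n) MvPolynomial.X 0 : Fin (n + 2) → PolyRing n)).toRingHom
  map_mem {i p} hp := by
    have h := MvPolynomial.IsHomogeneous.aeval (m := i) (n := 1) (φ := p) hp
      (Fin.snoc (α := fun _ => PolyRing n) MvPolynomial.X 0 : Fin (n + 2) → PolyRing n)
      (fun j => by
        refine Fin.lastCases ?_ (fun j => ?_) j
        · rw [Fin.snoc_last]
          exact MvPolynomial.isHomogeneous_zero _ _ _
        · rw [Fin.snoc_castSucc]
          exact MvPolynomial.isHomogeneous_X _ _)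
    rw [one_mul] at h
    exact h

theorem killLast_rename (n : ℕ) (p : PolyRing n) :
    killLast n (MvPolynomial.rename Fin.castSucc p) = p := by
  refine (MvPolynomial.aeval_rename (R := ℂ) Fin.castSucc
    (Fin.snoc (α := fun _ => PolyRing n) MvPolynomial.X 0 : Fin (n + 2) → PolyRing n) p).trans ?_
  have : (Fin.snoc (α := fun _ => PolyRing n) MvPolynomial.X 0 : Fin (n + 2) → PolyRing n) ∘
      Fin.castSucc = MvPolynomial.X := funext fun j => Fin.snoc_castSucc _ _ _
  rw [this, MvPolynomial.aeval_X_left_apply]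

theorem irrelevant_le_map_killLast (n : ℕ) :
    HomogeneousIdeal.irrelevant (polyGrading n) ≤
      (HomogeneousIdeal.irrelevant (polyGrading (n + 1))).map (killLast n) := by
  refine (HomogeneousIdeal.toIdeal_irrelevant_le _).2 fun i hi p hp => ?_
  have h : MvPolynomial.rename Fin.castSucc p ∈
      HomogeneousIdeal.irrelevant (polyGrading (n + 1)) :=
    (HomogeneousIdeal.toIdeal_irrelevant_le (polyGrading (n + 1))).1 le_rfl i hi
      (MvPolynomial.IsHomogeneous.rename_isHomogeneous (f := Fin.castSucc) hp)
  rw [← killLast_rename n p]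
  exact Ideal.mem_map_of_mem (killLast n) h

/-- The inclusion `ℙⁿ ⟶ ℙⁿ⁺¹` of the hyperplane `xₙ₊₁ = 0`. -/
def hyperplaneInclusion (n : ℕ) : PSpace n ⟶ PSpace (n + 1) :=
  Proj.map (killLast n) (irrelevant_le_map_killLast n)

end

noncomputable section

universe u

open EvenClifford TensorProduct

/-! The theorem says that forming the even Clifford algebra commutes with restriction to the
hyperplane, and the proof compares explicit local bases on both sides.

Where `E` has a frame of four sections and `L^*` is freely generated by a section `f`, the presheaf
`T(E ⊗ E ⊗ L^*)/(J₁ + J₂)` is the even part of the ordinary Clifford algebra of the scalar form `f ∘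
q` (`ofEven_bijective`). That even part is free of rank 8 on the increasing words of even length in
the frame (`bijective_evenWord`). The words restrict to words, so they form a basis over every
smaller open set, and such a basis survives sheafification (`isBasis_toSections`). On the chart `x_j
≠ 0` the powers `x_j^{-w}` supply the frame of the split bundle and `x_j^{-1}` generates the dual of
`𝒪(1)`; the charts cover, so both algebras are locally free.

Setting `x₃ = 0` kills `x₃ F̄`, hence sends the coefficients of the larger cubic to those of the
smaller one (`killLast_matrix`). Restriction of sections to the hyperplane therefore respects the
two quadratic forms and induces a morphism `p` of even Clifford algebras. It carries the frame and
generator on a chart to the corresponding frame and generator, hence words to words: around every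
point of the image, a basis maps to a basis (`Hom.HasLocalBases`).

The rest is formal. A morphism with local bases has the universal property of the pullback: each
module map from `B_Y` to `p_* N` extends uniquely to one from `B_X` to `N`
(`Hom.HasLocalBases.existsUnique`). Strictness follows by Yoneda and adjunction. Taking `N = f_*
B_Z` and checking multiplicativity on a basis gives the lifts that make the square cartesian. -/

theorem exists_lift_smul {R M D A : Type*} [CommRing R] [AddCommGroup M] [Module R M]
    [AddCommGroup D] [Module R D] [AddCommGroup A] [Module R A] (c : D →ₗ[R] R)
    (β : M →ₗ[R] M →ₗ[R] A) :
    ∃ γ : M ⊗[R] (M ⊗[R] D) →ₗ[R] A, ∀ u v g, γ (u ⊗ₜ (v ⊗ₜ g)) = c g • β u v :=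
  ⟨TensorProduct.lift β ∘ₗ LinearMap.lTensor M (TensorProduct.rid R M ∘ₗ LinearMap.lTensor M c),
    fun u v g => by simp⟩

/-! ### A basis of the even Clifford algebra of a free module of rank four -/

namespace CliffordAlgebra

variable {R M : Type*} [CommRing R] [AddCommGroup M] [Module R M] {Q : QuadraticForm R M}

/-- On a free module, scalars embed into the Clifford algebra. -/
theorem algebraMap_injective_of_free [Module.Free R M] :
    Function.Injective (algebraMap R (CliffordAlgebra Q)) := by
  -- On a free module every quadratic form comes from a bilinear form, not necessarily symmetric, so
  -- no division by 2 is needed. Changing the form along `B` lands in the exterior algebra (`Q' =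
  -- 0`) and fixes scalars, and there the scalars have a left inverse.
  obtain ⟨B, hB⟩ := LinearMap.BilinMap.toQuadraticMap_surjective (R := R) (M := M) (N := R) (-Q)
  intro r s h
  have h' := congrArg (changeForm (Q' := 0) (B := B) (by rw [hB, zero_sub])) h
  rw [changeForm_algebraMap, changeForm_algebraMap] at h'
  exact (ExteriorAlgebra.algebraMap_leftInverse (R := R) M).injective h'

variable (Q) in
/-- The spans of the increasing words of even and odd length in a list of vectors. -/
def wordSpan : List M → Submodule R (CliffordAlgebra Q) × Submodule R (CliffordAlgebra Q)
  | [] => (1, ⊥)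
  | v :: l => ((wordSpan l).1 ⊔ (wordSpan l).2.map (LinearMap.mulLeft R (ι Q v)),
      (wordSpan l).2 ⊔ (wordSpan l).1.map (LinearMap.mulLeft R (ι Q v)))

/-- Induction on the list: a letter multiplied onto a word is either equal to the head `v`, where `v
* v` is a scalar, or is moved past `v` with the Clifford relation, at the cost of a scalar multiple
of the shorter word. -/
theorem wordSpan_mul_mem {l : List M} {m : M} (hm : m ∈ l) :
    (∀ x ∈ (wordSpan Q l).1, ι Q m * x ∈ (wordSpan Q l).2) ∧
      ∀ x ∈ (wordSpan Q l).2, ι Q m * x ∈ (wordSpan Q l).1 := by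
  induction l with
  | nil => cases hm
  | cons v l ih =>
    -- The roles of `S` and `T` are interchangeable, so one statement handles both parities.
    have key : ∀ S T : Submodule R (CliffordAlgebra Q),
        (m ∈ l → (∀ x ∈ S, ι Q m * x ∈ T) ∧ ∀ x ∈ T, ι Q m * x ∈ S) →
        ∀ x ∈ S ⊔ T.map (LinearMap.mulLeft R (ι Q v)),
          ι Q m * x ∈ T ⊔ S.map (LinearMap.mulLeft R (ι Q v)) := by
      intro S T h x hx
      obtain ⟨y, hy, _, ⟨z, hz, rfl⟩, rfl⟩ := Submodule.mem_sup.1 hx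
      rw [mul_add, LinearMap.mulLeft_apply]
      rcases List.mem_cons.1 hm with rfl | hm
      · refine add_mem (Submodule.mem_sup_right ⟨y, hy, rfl⟩) (Submodule.mem_sup_left ?_)
        rw [← mul_assoc, ι_sq_scalar, ← Algebra.smul_def]
        exact T.smul_mem _ hz
      · refine add_mem (Submodule.mem_sup_left ((h hm).1 y hy)) ?_
        rw [← mul_assoc, eq_sub_of_add_eq (ι_mul_ι_add_swap m v), sub_mul, ← Algebra.smul_def,
          mul_assoc]
        exact sub_mem (Submodule.mem_sup_left (T.smul_mem _ hz))
          (Submodule.mem_sup_right ⟨_, (h hm).2 z hz, rfl⟩)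
    exact ⟨key _ _ ih, key _ _ fun h => (ih h).symm⟩

theorem one_mem_wordSpan (l : List M) : 1 ∈ (wordSpan Q l).1 := by
  induction l with
  | nil => exact Submodule.one_le.1 le_rfl
  | cons v l ih => exact Submodule.mem_sup_left ih

/-- Since the letters span, left multiplication by any vector exchanges the two word spans. The even
part is built from scalars by multiplying with pairs of vectors, so it never leaves the even span.
-/
theorem mem_wordSpan_of_mem_even {l : List M} (hl : Submodule.span R {m | m ∈ l} = ⊤)
    {x : CliffordAlgebra Q} (hx : x ∈ evenOdd Q 0) : x ∈ (wordSpan Q l).1 := by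
  have h : ∀ m : M, (∀ x ∈ (wordSpan Q l).1, ι Q m * x ∈ (wordSpan Q l).2) ∧
      ∀ x ∈ (wordSpan Q l).2, ι Q m * x ∈ (wordSpan Q l).1 := by
    intro m
    have hm : m ∈ Submodule.span R {m | m ∈ l} := hl ▸ Submodule.mem_top
    induction hm using Submodule.span_induction with
    | mem m hm => exact wordSpan_mul_mem hm
    | zero => simp
    | add m m' _ _ h h' =>
      simp only [map_add, add_mul]
      exact ⟨fun x hx => add_mem (h.1 x hx) (h'.1 x hx), fun x hx => add_mem (h.2 x hx) (h'.2 x hx)⟩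
    | smul r m _ h =>
      simp only [map_smul, smul_mul_assoc]
      exact ⟨fun x hx => Submodule.smul_mem _ _ (h.1 x hx),
        fun x hx => Submodule.smul_mem _ _ (h.2 x hx)⟩
  induction x, hx using even_induction with
  | algebraMap r =>
    rw [Algebra.algebraMap_eq_smul_one]
    exact Submodule.smul_mem _ _ (one_mem_wordSpan l)
  | add x y _ _ hx hy => exact add_mem hx hy
  | ι_mul_ι_mul m₁ m₂ x _ hx =>
    rw [mul_assoc]
    exact (h m₁).2 _ ((h m₂).1 _ hx)

theorem mem_wordSpan_pair_even {v w : M} {x : CliffordAlgebra Q}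
    (hx : x ∈ (wordSpan Q [v, w]).1) : ∃ r s : R, x = r • 1 + s • (ι Q v * ι Q w) := by
  simp only [wordSpan, Submodule.map_bot, sup_bot_eq, bot_sup_eq, Submodule.one_eq_span,
    Submodule.map_span, Set.image_singleton, LinearMap.mulLeft_apply, mul_one] at hx
  rw [← Submodule.span_union, ← Set.insert_eq] at hx
  obtain ⟨r, s, h⟩ := Submodule.mem_span_pair.1 hx
  exact ⟨r, s, h.symm⟩

theorem mem_wordSpan_pair_odd {v w : M} {x : CliffordAlgebra Q}
    (hx : x ∈ (wordSpan Q [v, w]).2) : ∃ r s : R, x = r • ι Q v + s • ι Q w := by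
  simp only [wordSpan, Submodule.map_bot, sup_bot_eq, bot_sup_eq, Submodule.one_eq_span,
    Submodule.map_span, Set.image_singleton, LinearMap.mulLeft_apply, mul_one] at hx
  rw [← Submodule.span_union, ← Set.insert_eq] at hx
  obtain ⟨r, s, h⟩ := Submodule.mem_span_pair.1 hx
  exact ⟨s, r, h.symm.trans (add_comm _ _)⟩

variable (Q) in
/-- The increasing words of even length in four vectors. -/
def evenWord (e : Fin 4 → M) : Fin 8 → even Q :=
  letI g i j := (even.ι Q).bilin (e i) (e j)
  ![1, g 0 1, g 0 2, g 0 3, g 1 2, g 1 3, g 2 3, g 0 1 * g 2 3]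

/-- Independence comes from contracting with the dual basis, which strips letters from the left of
an ordered word; this works for any form, orthogonal basis or not. Generation is the spanning by
increasing words. -/
theorem bijective_evenWord (b : Module.Basis (Fin 4) R M) :
    Function.Bijective (fun c : Fin 8 → R => ∑ i, c i • evenWord Q b i) := by
  -- The word of length four is bracketed to the right so that contractions can remove its letters
  -- one after another.
  have hcoe : ∀ c : Fin 8 → R, ((∑ i, c i • evenWord Q b i : even Q) : CliffordAlgebra Q) =
      c 0 • 1 + c 1 • (ι Q (b 0) * ι Q (b 1)) + c 2 • (ι Q (b 0) * ι Q (b 2)) +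
      c 3 • (ι Q (b 0) * ι Q (b 3)) + c 4 • (ι Q (b 1) * ι Q (b 2)) +
      c 5 • (ι Q (b 1) * ι Q (b 3)) + c 6 • (ι Q (b 2) * ι Q (b 3)) +
      c 7 • (ι Q (b 0) * (ι Q (b 1) * (ι Q (b 2) * ι Q (b 3)))) := by
    intro c
    rw [← mul_assoc (ι Q (b 0))]
    simp only [Fin.sum_univ_eight]
    rfl
  have : Module.Free R M := Module.Free.of_basis b
  have hz : ∀ r : R, r • (1 : CliffordAlgebra Q) = 0 → r = 0 := fun r hr =>
    algebraMap_injective_of_free (Q := Q) (by rw [Algebra.algebraMap_eq_smul_one, hr, map_zero])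
  constructor
  · have hlin : ∀ c : Fin 8 → R, ∑ i, c i • evenWord Q b i = 0 → c = 0 := by
      intro c hc
      have h0 := (hcoe c).symm.trans (congrArg Subtype.val hc)
      rw [ZeroMemClass.coe_zero] at h0
      -- `d i` contracts a relation with the `i`-th coordinate. Words beginning with letter 0 are
      -- treated first, and among them the word of length four; each coefficient found is
      -- substituted back before the next contraction.
      have d := fun i x (h : x = (0 : CliffordAlgebra Q)) =>
        (congrArg (contractLeft (Q := Q) (b.coord i)) h).trans (map_zero _)
      have hmul : ∀ i j x, contractLeft (Q := Q) (b.coord i) (ι Q (b j) * x) =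
          (if j = i then x else 0) - ι Q (b j) * contractLeft (b.coord i) x := fun i j x => by
        rw [contractLeft_ι_mul, Module.Basis.coord_apply, Module.Basis.repr_self,
          Finsupp.single_apply, ite_smul, one_smul, zero_smul]
      have hι : ∀ i j, contractLeft (Q := Q) (b.coord i) (ι Q (b j)) = if j = i then 1 else 0 :=
        fun i j => by simpa [contractLeft_one] using hmul i j 1
      have h1 := d 0 _ h0
      simp [hmul, hι, contractLeft_one] at h1
      have h2 := d 1 _ h1
      simp [hmul, hι] at h2
      have h3 := d 3 _ (d 2 _ h2)
      simp [hmul, hι, contractLeft_one] at h3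
      have c7 := hz _ h3
      simp only [c7, zero_smul, add_zero] at h0 h1 h2
      have c1 := hz _ h2
      simp only [c1, zero_smul, zero_add, add_zero] at h0 h1
      have h4 := d 2 _ h1
      simp [hι] at h4
      have c2 := hz _ h4
      simp only [c2, zero_smul, zero_add, add_zero] at h0 h1
      have h5 := d 3 _ h1
      simp [hι] at h5
      have c3 := hz _ h5
      simp only [c3, zero_smul, add_zero] at h0
      have h6 := d 1 _ h0
      simp [hmul, hι, contractLeft_one] at h6
      have h7 := d 2 _ h6
      simp [hι] at h7
      have c4 := hz _ h7
      simp only [c4, zero_smul, zero_add, add_zero] at h0 h6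
      have h8 := d 3 _ h6
      simp [hι] at h8
      have c5 := hz _ h8
      simp only [c5, zero_smul, add_zero] at h0
      have h9 := d 3 _ (d 2 _ h0)
      simp [hmul, hι, contractLeft_one] at h9
      have c6 := hz _ h9
      simp only [c6, zero_smul, add_zero] at h0
      have c0 := hz _ h0
      funext i
      fin_cases i
      exacts [c0, c1, c2, c3, c4, c5, c6, c7]
    intro c c' h
    refine sub_eq_zero.1 (hlin _ ?_)
    simpa only [Pi.sub_apply, sub_smul, Finset.sum_sub_distrib, sub_eq_zero] using h
  · rintro ⟨x, hx⟩
    have hl : Submodule.span R {m | m ∈ [b 0, b 1, b 2, b 3]} = ⊤ := by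
      rw [← b.span_eq]
      congr 1
      ext m
      simp [Fin.exists_fin_succ, eq_comm]
    -- Splitting off `b 0` and then `b 1` leaves four words in the pair `b 2`, `b 3`, two even and
    -- two odd, with two coefficients each: eight in all.
    obtain ⟨y, hy, _, ⟨z, hz, rfl⟩, rfl⟩ := Submodule.mem_sup.1 (mem_wordSpan_of_mem_even hl hx)
    obtain ⟨y₁, hy₁, _, ⟨y₂, hy₂, rfl⟩, rfl⟩ := Submodule.mem_sup.1 hy
    obtain ⟨z₁, hz₁, _, ⟨z₂, hz₂, rfl⟩, rfl⟩ := Submodule.mem_sup.1 hz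
    obtain ⟨r₀, r₆, rfl⟩ := mem_wordSpan_pair_even hy₁
    obtain ⟨r₄, r₅, rfl⟩ := mem_wordSpan_pair_odd hy₂
    obtain ⟨r₂, r₃, rfl⟩ := mem_wordSpan_pair_odd hz₁
    obtain ⟨r₁, r₇, rfl⟩ := mem_wordSpan_pair_even hz₂
    refine ⟨![r₀, r₁, r₂, r₃, r₄, r₅, r₆, r₇], Subtype.ext ((hcoe _).trans ?_)⟩
    simp only [Matrix.cons_val, LinearMap.mulLeft_apply, mul_add, mul_smul_comm, mul_one]
    abel

end CliffordAlgebra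

/-! ### Comparison with the classical even Clifford algebra -/

namespace ModuleQuadraticForm

open CliffordAlgebra

variable {X : Scheme.{u}} {E L : X.Modules} (q : ModuleQuadraticForm E L)

/-- The increasing words of even length in four sections of `E`, for a section `f` of `L^*`. -/
def evenWord {U : X.Opens} (e : Fin 4 → Γ(E, U)) (f : DualSections L U) :
    Fin 8 → q.PreSections U :=
  letI g i j := PreSections.gen q (e i) (e j) f
  ![1, g 0 1, g 0 2, g 0 3, g 1 2, g 1 3, g 2 3, g 0 1 * g 2 3]

theorem res_evenWord {U V : X.Opens} (h : U ≤ V) (e : Fin 4 → Γ(E, V)) (f : DualSections L V)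
    (i : Fin 8) :
    PreSections.res h (q.evenWord e f i) =
      q.evenWord (fun k => resM E h (e k)) (DualSections.res h f) i := by
  fin_cases i <;> simp [evenWord, PreSections.res_gen]

/-- The scalar quadratic form `v ↦ f(q(v))`. -/
def scalarForm {U : X.Opens} (f : DualSections L U) : QuadraticForm Γ(X, U) Γ(E, U) :=
  (f.eval le_rfl).compQuadraticMap (q.form U)

theorem scalarForm_apply {U : X.Opens} (f : DualSections L U) (v : Γ(E, U)) :
    q.scalarForm f v = f.eval le_rfl (q.form U v) := rfl

/-- The map from the even part of a Clifford algebra to the sections of the even Clifford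
algebra. -/
def ofEven {U : X.Opens} (f : DualSections L U) :
    even (q.scalarForm f) →ₐ[Γ(X, U)] q.PreSections U :=
  even.lift (q.scalarForm f)
    { bilin := LinearMap.mk₂ _ (fun u v => PreSections.gen q u v f)
        (fun u u' v => PreSections.gen_add_left u u' v f)
        (fun r u v => PreSections.gen_smul_left r u v f)
        (fun u v v' => PreSections.gen_add_mid u v v' f)
        (fun r u v => PreSections.gen_smul_mid r u v f)
      contract := fun v => PreSections.gen_contract q v f
      contract_mid := fun u v w => PreSections.gen_contract_mid q u v w f f }

theorem ofEven_ι {U : X.Opens} (f : DualSections L U) (u v : Γ(E, U)) :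
    q.ofEven f ((even.ι _).bilin u v) = PreSections.gen q u v f :=
  even.lift_ι _ _ _ _

/-- If every section of `L^*` is uniquely `g = c(g) f`, the assignment `u ⊗ v ⊗ g ↦ c(g) u v` is
inverse to `ofEven`. It respects both families of relations because `g(q(v)) = c(g) f(q(v))`. -/
theorem ofEven_bijective {U : X.Opens} (f : DualSections L U)
    (hf : Function.Bijective fun r : Γ(X, U) => r • f) : Function.Bijective (q.ofEven f) := by
  let c : DualSections L U →ₗ[Γ(X, U)] Γ(X, U) :=
    (LinearEquiv.ofBijective (LinearMap.toSpanSingleton Γ(X, U) _ f) hf).symm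
  have hc : ∀ g, c g • f = g := fun g =>
    (LinearEquiv.ofBijective (LinearMap.toSpanSingleton Γ(X, U) _ f) hf).apply_symm_apply g
  have hcf : c f = 1 := hf.1 ((hc f).trans (one_smul _ f).symm)
  have hev : ∀ (g : DualSections L U) (v : Γ(E, U)),
      c g * q.scalarForm f v = g.eval le_rfl (q.form U v) := fun g v => by
    conv_rhs => rw [← hc g]
    simp only [DualSections.eval_smul, resO_id, LinearMap.smul_apply, smul_eq_mul,
      scalarForm_apply]
  let β := (even.ι (q.scalarForm f)).bilin
  obtain ⟨γ, hγ⟩ : ∃ γ : q.Gen U →ₗ[Γ(X, U)] even (q.scalarForm f),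
      ∀ u v g, γ (u ⊗ₜ (v ⊗ₜ g)) = c g • β u v := exists_lift_smul c β
  let t : q.PreSections U →ₐ[Γ(X, U)] even (q.scalarForm f) :=
    RingQuot.liftAlgHom Γ(X, U) (s := q.Rel U) ⟨TensorAlgebra.lift Γ(X, U) γ, by
      intro x y hxy
      induction hxy with
      | contract v g =>
        rw [TensorAlgebra.lift_ι_apply, hγ, AlgHom.commutes, (even.ι (q.scalarForm f)).contract,
          ← hev, map_mul, Algebra.smul_def]
      | contract_mid u v w g g' =>
        rw [map_mul, map_smul, TensorAlgebra.lift_ι_apply, TensorAlgebra.lift_ι_apply,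
          TensorAlgebra.lift_ι_apply, hγ, hγ, hγ, smul_mul_smul_comm,
          (even.ι (q.scalarForm f)).contract_mid, ← hev, smul_smul, smul_smul]
        congr 1
        ring⟩
  have ht : ∀ u v g, t (PreSections.gen q u v g) = c g • β u v := fun u v g =>
    (RingQuot.liftAlgHom_mkAlgHom_apply Γ(X, U) _ _ _).trans
      ((TensorAlgebra.lift_ι_apply _ _).trans (hγ u v g))
  refine Function.bijective_iff_has_inverse.2 ⟨t, fun x => ?_, fun x => ?_⟩
  · refine AlgHom.congr_fun (φ₁ := t.comp (q.ofEven f)) (φ₂ := AlgHom.id _ _)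
      (even.algHom_ext _ (EvenHom.ext (LinearMap.ext₂ fun u v => ?_))) x
    simp only [EvenHom.compr₂_bilin, LinearMap.compr₂_apply, AlgHom.toLinearMap_apply,
      AlgHom.comp_apply, ofEven_ι, ht, hcf, one_smul, AlgHom.id_apply]
    rfl
  · refine RingHom.congr_fun (f := ((q.ofEven f).comp t).toRingHom) (g := RingHom.id _)
      (PreSections.ringHom_ext (fun r => ?_) fun u v g => ?_) x
    · exact AlgHom.commutes ((q.ofEven f).comp t) r
    · change q.ofEven f (t (PreSections.gen q u v g)) = PreSections.gen q u v g
      rw [ht, map_smul, ofEven_ι, ← PreSections.gen_smul_right, hc]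

theorem ofEven_evenWord {U : X.Opens} (e : Fin 4 → Γ(E, U)) (f : DualSections L U) (i : Fin 8) :
    q.ofEven f (CliffordAlgebra.evenWord _ e i) = q.evenWord e f i := by
  fin_cases i <;> simp [CliffordAlgebra.evenWord, evenWord, ofEven_ι]

theorem evenWord_bijective {U : X.Opens} (b : Module.Basis (Fin 4) Γ(X, U) Γ(E, U))
    (f : DualSections L U) (hf : Function.Bijective fun r : Γ(X, U) => r • f) :
    Function.Bijective fun c : Fin 8 → Γ(X, U) => ∑ i, c i • q.evenWord b f i := by
  convert (q.ofEven_bijective f hf).comp (bijective_evenWord (Q := q.scalarForm f) b) using 1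
  funext c
  simp only [Function.comp_apply, map_sum, map_smul, ofEven_evenWord]

end ModuleQuadraticForm

/-! ### Gluing locally determined sections -/

namespace TopCat.Sheaf

variable {C : Type*} [Category* C] {FC : C → C → Type*} {CC : C → Type*}
  [∀ X Y, FunLike (FC X Y) (CC X) (CC Y)] [ConcreteCategory C FC]
  [Limits.HasLimitsOfSize.{u, u} C] [(CategoryTheory.forget C).ReflectsIsomorphisms]
  [Limits.PreservesLimitsOfSize.{u, u} (CategoryTheory.forget C)]
  {X : TopCat.{u}} (F : TopCat.Sheaf C X)

/-- Sections which agree near every point are equal. -/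
theorem eq_of_forall_mem {U : Opens X} {s t : ToType (F.1.obj (op U))}
    (h : ∀ x ∈ U, ∃ (V : Opens X) (hV : V ≤ U), x ∈ V ∧
      F.1.map (homOfLE hV).op s = F.1.map (homOfLE hV).op t) : s = t := by
  choose V hV hxV H using h
  exact F.eq_of_locally_eq' (fun x : U => V x.1 x.2) U (fun x => homOfLE (hV x.1 x.2))
    (fun x hx => Opens.mem_iSup.2 ⟨⟨x, hx⟩, hxV x hx⟩) s t fun x => H x.1 x.2

/-- A section that is locally determined by a property exists globally. -/
theorem exists_of_locally_existsUnique {U : Opens X}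
    (P : ∀ V : Opens X, V ≤ U → ToType (F.1.obj (op V)) → Prop)
    (hres : ∀ (V W : Opens X) (h : V ≤ W) (hW : W ≤ U) s, P W hW s →
      P V (h.trans hW) (F.1.map (homOfLE h).op s))
    (huniq : ∀ (V : Opens X) (hV : V ≤ U) s t, P V hV s → P V hV t → s = t)
    (hex : ∀ x ∈ U, ∃ (V : Opens X) (hV : V ≤ U), x ∈ V ∧ ∃ s, P V hV s) :
    ∃ s : ToType (F.1.obj (op U)), ∀ (V : Opens X) (hV : V ≤ U) t, P V hV t →
      F.1.map (homOfLE hV).op s = t := by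
  choose V hV hxV s hs using hex
  obtain ⟨g, hg, -⟩ := F.existsUnique_gluing' (fun x : U => V x.1 x.2) U
    (fun x => homOfLE (hV x.1 x.2)) (fun x hx => Opens.mem_iSup.2 ⟨⟨x, hx⟩, hxV x hx⟩)
    (fun x => s x.1 x.2) fun x y => huniq _ (inf_le_left.trans (hV x.1 x.2)) _ _
      (hres _ _ inf_le_left _ _ (hs x.1 x.2)) (hres _ _ inf_le_right _ _ (hs y.1 y.2))
  refine ⟨g, fun W hW t ht => F.eq_of_forall_mem fun x hx => ?_⟩
  refine ⟨W ⊓ V x (hW hx), inf_le_left, ⟨hx, hxV x (hW hx)⟩, ?_⟩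
  refine huniq _ (inf_le_left.trans hW) _ _ ?_ (hres _ _ inf_le_left hW _ ht)
  convert hres _ _ inf_le_right _ _ (hs x (hW hx)) using 1
  rw [← hg ⟨x, hW hx⟩, ← ConcreteCategory.comp_apply, ← ConcreteCategory.comp_apply,
    ← F.1.map_comp, ← F.1.map_comp]
  rfl

end TopCat.Sheaf

namespace AlgebraSheaf

variable {X : Scheme.{u}} (B : AlgebraSheaf X)

theorem res_res {U V W : X.Opens} (h : U ≤ V) (k : V ≤ W) (b : B.Sections W) :
    B.res h (B.res k b) = B.res (h.trans k) b :=
  (ConcreteCategory.congr_hom (B.sheaf.obj.map_comp (homOfLE k).op (homOfLE h).op) b).symm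

theorem res_self {U : X.Opens} (b : B.Sections U) : B.res le_rfl b = b :=
  ConcreteCategory.congr_hom (B.sheaf.obj.map_id (op U)) b

theorem eq_of_locally {U : X.Opens} {b b' : B.Sections U}
    (h : ∀ x ∈ U, ∃ (V : X.Opens) (hV : V ≤ U), x ∈ V ∧ B.res hV b = B.res hV b') : b = b' :=
  TopCat.Sheaf.eq_of_forall_mem (X := X.toTopCat) (C := RingCat.{u}) B.sheaf h

/-- The sections `s` are a basis of `B` over every open subset of `U`. -/
def IsBasis {U : X.Opens} {n : ℕ} (s : Fin n → B.Sections U) : Prop :=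
  ∀ (V : X.Opens) (h : V ≤ U), Function.Bijective
    (fun c : Fin n → Γ(X, V) => ∑ i, B.algMap V (c i) * B.res h (s i))

variable {B}

theorem res_sum {U V W : X.Opens} {n : ℕ} (h : V ≤ W) (k : W ≤ U) (c : Fin n → Γ(X, W))
    (s : Fin n → B.Sections U) :
    B.res h (∑ i, B.algMap W (c i) * B.res k (s i)) =
      ∑ i, B.algMap V (resO h (c i)) * B.res (h.trans k) (s i) := by
  simp only [map_sum, map_mul, res_algMap, res_res]

end AlgebraSheaf

theorem funcs_eq_of_locally {X : Scheme.{u}} {U : X.Opens} {r r' : Γ(X, U)}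
    (h : ∀ x ∈ U, ∃ (V : X.Opens) (hV : V ≤ U), x ∈ V ∧ resO hV r = resO hV r') : r = r' :=
  TopCat.Sheaf.eq_of_forall_mem (X := X.toTopCat) (C := CommRingCat.{u}) X.sheaf h

/-! ### Bases and sheafification -/

namespace ModuleQuadraticForm

variable {X : Scheme.{u}} {E L : X.Modules} (q : ModuleQuadraticForm E L)

/-- The map from the presheaf to its sheafification on sections. -/
def toSections (U : X.Opens) : q.PreSections U →+* q.evenClifford.Sections U :=
  ((toSheafify (Opens.grothendieckTopology X) q.prePresheaf).app (op U)).hom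

theorem res_toSections {U V : X.Opens} (h : U ≤ V) (a : q.PreSections V) :
    q.evenClifford.res h (q.toSections V a) = q.toSections U (PreSections.res h a) :=
  (ConcreteCategory.congr_hom ((toSheafify (Opens.grothendieckTopology X)
    q.prePresheaf).naturality (homOfLE h).op) a).symm

theorem algMap_eq_toSections {U : X.Opens} (r : Γ(X, U)) :
    q.evenClifford.algMap U r = q.toSections U (algebraMap _ _ r) := rfl

theorem toSections_locally_injective {U : X.Opens} {a b : q.PreSections U}
    (h : q.toSections U a = q.toSections U b) {x : X} (hx : x ∈ U) :
    ∃ (V : X.Opens) (hV : V ≤ U), x ∈ V ∧ PreSections.res hV a = PreSections.res hV b := by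
  obtain ⟨V, i, hi, hxV⟩ := Presheaf.equalizerSieve_mem (Opens.grothendieckTopology X)
    (toSheafify (Opens.grothendieckTopology X) q.prePresheaf) a b h x hx
  exact ⟨V, leOfHom i, hxV, hi⟩

theorem toSections_locally_surjective {U : X.Opens} (b : q.evenClifford.Sections U) {x : X}
    (hx : x ∈ U) : ∃ (V : X.Opens) (hV : V ≤ U), x ∈ V ∧
      ∃ a : q.PreSections V, q.toSections V a = q.evenClifford.res hV b := by
  obtain ⟨V, i, ⟨a, ha⟩, hxV⟩ := Presheaf.imageSieve_mem (Opens.grothendieckTopology X)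
    (toSheafify (Opens.grothendieckTopology X) q.prePresheaf) (U := op U) b x hx
  exact ⟨V, leOfHom i, hxV, a, ha⟩

theorem presections_res_res {U V W : X.Opens} (h : U ≤ V) (k : V ≤ W) (a : q.PreSections W) :
    PreSections.res h (PreSections.res k a) = PreSections.res (h.trans k) a :=
  (ConcreteCategory.congr_hom (q.prePresheaf.map_comp (homOfLE k).op (homOfLE h).op) a).symm

/-- Sections forming a basis of the presheaf over all smaller open subsets form a basis of its
sheafification. -/
theorem isBasis_toSections {U : X.Opens} {n : ℕ} (s : Fin n → q.PreSections U)
    (hs : ∀ (V : X.Opens) (h : V ≤ U), Function.Bijective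
      fun c : Fin n → Γ(X, V) => ∑ i, c i • PreSections.res h (s i)) :
    q.evenClifford.IsBasis fun i => q.toSections U (s i) := by
  have hsum : ∀ (V : X.Opens) (h : V ≤ U) (c : Fin n → Γ(X, V)),
      ∑ i, q.evenClifford.algMap V (c i) * q.evenClifford.res h (q.toSections U (s i)) =
        q.toSections V (∑ i, c i • PreSections.res h (s i)) := fun V h c => by
    simp only [map_sum, Algebra.smul_def, map_mul, res_toSections, algMap_eq_toSections]
  -- A relation in the sheafification already holds in the presheaf near each point, where the
  -- coefficients agree by freeness; they then agree globally because `𝒪` is a sheaf.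
  have hinj : ∀ (V : X.Opens) (h : V ≤ U), Function.Injective (fun c : Fin n → Γ(X, V) =>
      ∑ i, q.evenClifford.algMap V (c i) * q.evenClifford.res h (q.toSections U (s i))) := by
    intro V h c c' hcc
    simp only [hsum] at hcc
    funext i
    refine funcs_eq_of_locally fun x hx => ?_
    obtain ⟨W, hW, hxW, H⟩ := q.toSections_locally_injective hcc hx
    refine ⟨W, hW, hxW, congrFun ((hs W (hW.trans h)).1 (a₁ := fun i => resO hW (c i))
      (a₂ := fun i => resO hW (c' i)) ?_) i⟩
    simp only [map_sum, Algebra.smul_def, map_mul, PreSections.res_algebraMap,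
      presections_res_res] at H ⊢
    exact H
  refine fun V h => ⟨hinj V h, fun b => ?_⟩
  -- Locally `b` comes from the presheaf and so has an expansion, whose coefficients are unique by
  -- `hinj`. Hence the `i`-th local coefficients glue to a function `r`.
  have hg : ∀ i, ∃ r : Γ(X, V), ∀ (W : X.Opens) (hW : W ≤ V) (t : Γ(X, W)),
      (∃ c : Fin n → Γ(X, W), c i = t ∧ q.evenClifford.res hW b =
        ∑ i, q.evenClifford.algMap W (c i) *
          q.evenClifford.res (hW.trans h) (q.toSections U (s i))) → resO hW r = t := fun i => by
    refine TopCat.Sheaf.exists_of_locally_existsUnique (X := X.toTopCat) (C := CommRingCat.{u})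
      X.sheaf (U := V) (fun W hW t => ∃ c : Fin n → Γ(X, W), c i = t ∧ q.evenClifford.res hW b =
        ∑ i, q.evenClifford.algMap W (c i) *
          q.evenClifford.res (hW.trans h) (q.toSections U (s i))) ?_ ?_ ?_
    · rintro W' W hW' hW _ ⟨c, rfl, hc⟩
      refine ⟨fun i => resO hW' (c i), rfl, ?_⟩
      rw [← AlgebraSheaf.res_sum hW' (hW.trans h), ← hc, AlgebraSheaf.res_res]
    · rintro W hW _ _ ⟨c, rfl, hc⟩ ⟨c', rfl, hc'⟩
      exact congrFun (hinj W (hW.trans h) (hc.symm.trans hc')) i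
    · intro x hx
      obtain ⟨W, hW, hxW, a, ha⟩ := q.toSections_locally_surjective b hx
      obtain ⟨c, rfl⟩ := (hs W (hW.trans h)).2 a
      exact ⟨W, hW, hxW, c i, c, rfl, ha.symm.trans (hsum _ _ c).symm⟩
  choose r hr using hg
  refine ⟨r, AlgebraSheaf.eq_of_locally _ fun x hx => ?_⟩
  obtain ⟨W, hW, hxW, a, ha⟩ := q.toSections_locally_surjective b hx
  obtain ⟨c, rfl⟩ := (hs W (hW.trans h)).2 a
  refine ⟨W, hW, hxW, ?_⟩
  rw [AlgebraSheaf.res_sum, ← ha, ← hsum]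
  exact Finset.sum_congr rfl fun i _ => by
    rw [hr i W hW (c i) ⟨c, rfl, ha.symm.trans (hsum _ _ c).symm⟩]

end ModuleQuadraticForm

/-! ### Module maps out of a sheaf of algebras -/

theorem modules_eq_of_locally {X : Scheme.{u}} {N : X.Modules} {U : X.Opens} {t t' : Γ(N, U)}
    (h : ∀ x ∈ U, ∃ (V : X.Opens) (hV : V ≤ U), x ∈ V ∧ resM N hV t = resM N hV t') : t = t' :=
  TopCat.Sheaf.eq_of_forall_mem (X := X.toTopCat) (C := Ab.{u}) ⟨N.presheaf, N.isSheaf⟩ h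

namespace AlgebraSheaf

variable {X : Scheme.{u}} {B : AlgebraSheaf X} {N : X.Modules}

/-- Morphisms from the module underlying a sheaf of algebras, on sections. -/
def appHom (g : B.toModules ⟶ N) (U : X.Opens) : B.Sections U →+ Γ(N, U) := (g.app U).hom

theorem appHom_res (g : B.toModules ⟶ N) {U V : X.Opens} (h : U ≤ V) (b : B.Sections V) :
    appHom g U (B.res h b) = resM N h (appHom g V b) :=
  appLin_res g h b

theorem appHom_mul (g : B.toModules ⟶ N) {U : X.Opens} (r : Γ(X, U)) (b : B.Sections U) :
    appHom g U (B.algMap U r * b) = r • appHom g U b :=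
  Scheme.Modules.Hom.app_smul g r b

theorem hom_ext_appHom {g g' : B.toModules ⟶ N} (h : ∀ U b, appHom g U b = appHom g' U b) :
    g = g' :=
  Scheme.Modules.hom_ext _ _ fun U => ConcreteCategory.hom_ext _ _ (h U)

/-- Construct a morphism of modules from its values on sections. -/
def homMk (g : ∀ U : X.Opens, B.Sections U →+ Γ(N, U))
    (hres : ∀ {U V : X.Opens} (h : U ≤ V) (b : B.Sections V), g U (B.res h b) = resM N h (g V b))
    (hmul : ∀ {U : X.Opens} (r : Γ(X, U)) (b : B.Sections U), g U (B.algMap U r * b) = r • g U b) :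
    B.toModules ⟶ N where
  val := PresheafOfModules.homMk
    { app := fun U => AddCommGrpCat.ofHom (g U.unop)
      naturality := fun U V i => by
        ext b
        exact hres (leOfHom i.unop) b }
    (fun U r m => hmul r m)

/-- A functional relation which is locally total is the graph of a morphism. -/
theorem exists_hom_of_graph (G : ∀ V : X.Opens, AddSubgroup (B.Sections V × Γ(N, V)))
    (hres : ∀ {U V : X.Opens} (h : U ≤ V) {b t}, (b, t) ∈ G V → (B.res h b, resM N h t) ∈ G U)
    (hmul : ∀ {V : X.Opens} (r : Γ(X, V)) {b t}, (b, t) ∈ G V → (B.algMap V r * b, r • t) ∈ G V)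
    (hzero : ∀ {V : X.Opens} {t}, (0, t) ∈ G V → t = 0)
    (hex : ∀ {V : X.Opens} (b : B.Sections V), ∀ x ∈ V, ∃ (W : X.Opens) (h : W ≤ V), x ∈ W ∧
      ∃ t, (B.res h b, t) ∈ G W) :
    ∃ g : B.toModules ⟶ N, ∀ (V : X.Opens) b t, (b, t) ∈ G V → appHom g V b = t := by
  have huniq : ∀ {V : X.Opens} {b t t'}, (b, t) ∈ G V → (b, t') ∈ G V → t = t' := by
    intro V b t t' h h'
    refine sub_eq_zero.1 (hzero ?_)
    simpa using sub_mem h h'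
  have hg : ∀ (V : X.Opens) (b : B.Sections V), ∃ t : Γ(N, V), ∀ (W : X.Opens) (h : W ≤ V) t',
      (B.res h b, t') ∈ G W → resM N h t = t' := fun V b =>
    TopCat.Sheaf.exists_of_locally_existsUnique (X := X.toTopCat) (C := Ab.{u})
      ⟨N.presheaf, N.isSheaf⟩ (U := V) (fun W h t => (B.res h b, t) ∈ G W)
      (fun W' W h hW t ht => by simpa only [res_res] using hres h ht)
      (fun W h t t' ht ht' => huniq ht ht') (hex b)
  choose g hg using hg
  -- A section `t` locally related to `b` must be the glued value `g V b`. Additivity, compatibility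
  -- with restriction and linearity of `g` are all read off from the graph through this criterion.
  have key : ∀ {V : X.Opens} {b : B.Sections V} {t : Γ(N, V)}, (∀ x ∈ V, ∃ (W : X.Opens)
      (h : W ≤ V), x ∈ W ∧ (B.res h b, resM N h t) ∈ G W) → g V b = t := fun {V b t} H =>
    modules_eq_of_locally fun x hx => by
      obtain ⟨W, h, hxW, H⟩ := H x hx
      exact ⟨W, h, hxW, hg _ _ _ _ _ H⟩
  have hloc : ∀ {V : X.Opens} (b : B.Sections V), ∀ x ∈ V, ∃ (W : X.Opens) (h : W ≤ V), x ∈ W ∧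
      (B.res h b, resM N h (g V b)) ∈ G W := fun {V} b x hx => by
    obtain ⟨W, h, hxW, t, ht⟩ := hex b x hx
    exact ⟨W, h, hxW, (hg _ _ _ _ _ ht).symm ▸ ht⟩
  have hadd : ∀ (V : X.Opens) (b b' : B.Sections V), g V (b + b') = g V b + g V b' :=
    fun V b b' => key fun x hx => by
      obtain ⟨W, h, hxW, H⟩ := hloc b x hx
      obtain ⟨W', h', hxW', H'⟩ := hloc b' x hx
      refine ⟨W ⊓ W', inf_le_left.trans h, ⟨hxW, hxW'⟩, ?_⟩
      have := add_mem (hres (inf_le_left : W ⊓ W' ≤ W) H) (hres (inf_le_right : W ⊓ W' ≤ W') H')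
      simpa only [res_res, resM_comp, map_add, Prod.mk_add_mk] using this
  refine ⟨homMk (fun V => AddMonoidHom.mk' (g V) (hadd V)) ?_ ?_, ?_⟩
  · intro U V h b
    refine key fun x hx => ?_
    obtain ⟨W, hW, hxW, H⟩ := hloc b x (h hx)
    refine ⟨W ⊓ U, inf_le_right, ⟨hxW, hx⟩, ?_⟩
    have := hres (inf_le_left : W ⊓ U ≤ W) H
    simpa only [res_res, resM_comp, AddMonoidHom.mk'_apply] using this
  · intro U r b
    refine key fun x hx => ?_
    obtain ⟨W, hW, hxW, H⟩ := hloc b x hx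
    refine ⟨W, hW, hxW, ?_⟩
    have := hmul (resO hW r) H
    simpa only [map_mul, res_algMap, resM_smul, AddMonoidHom.mk'_apply] using this
  · intro V b t h
    exact key fun x hx => ⟨V, le_rfl, hx, by simpa only [res_self, resM_id] using h⟩

end AlgebraSheaf

/-! ### Morphisms with local bases are strict and cartesian -/

namespace NCScheme

variable {X Y Z : NCScheme.{u}}

/-- Around every point of the image, `B_Y` has a basis mapping to a basis of `B_X`. -/
def Hom.HasLocalBases (p : X.Hom Y) : Prop :=
  ∀ x : X.base, ∃ U : Y.base.Opens, p.base x ∈ U ∧ ∃ (n : ℕ) (s : Fin n → Y.alg.Sections U),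
    Y.alg.IsBasis s ∧ X.alg.IsBasis fun i => p.app U (s i)

open AlgebraSheaf

/-- This is the universal property of `p^* B_Y`, proved for `B_X` without describing the pullback.
The extension must send `r · p(β)` to `r · φ(β)`; the relation generated by these pairs is the graph
of a map, since in a local basis both entries of a pair have the same coefficients. -/
theorem Hom.HasLocalBases.existsUnique {p : X.Hom Y} (hp : p.HasLocalBases) {N : X.base.Modules}
    (φ : Y.alg.toModules ⟶ (Scheme.Modules.pushforward p.base).obj N) :
    ∃! g : X.alg.toModules ⟶ N, p.moduleMap ≫ (Scheme.Modules.pushforward p.base).map g = φ := by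
  let φ' (U : Y.base.Opens) : Y.alg.Sections U →+ Γ(N, p.base ⁻¹ᵁ U) := appHom φ U
  have φres : ∀ {U V : Y.base.Opens} (h : U ≤ V) (b : Y.alg.Sections V),
      φ' U (Y.alg.res h b) = resM N (p.base.preimage_mono h) (φ' V b) :=
    fun h b => appHom_res φ h b
  have φmul : ∀ {U : Y.base.Opens} (r : Γ(Y.base, U)) (b : Y.alg.Sections U),
      φ' U (Y.alg.algMap U r * b) = p.base.app U r • φ' U b := fun r b => appHom_mul φ r b
  let gens (V : X.base.Opens) : Set (X.alg.Sections V × Γ(N, V)) :=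
    {z | ∃ (U : Y.base.Opens) (h : V ≤ p.base ⁻¹ᵁ U) (r : Γ(X.base, V)) (β : Y.alg.Sections U),
      z = (X.alg.algMap V r * X.alg.res h (p.app U β), r • resM N h (φ' U β))}
  let G (V : X.base.Opens) := AddSubgroup.closure (gens V)
  -- Every pair in the relation is given by a single coefficient vector, used on both sides. With
  -- independence of the image basis, first entry 0 then forces second entry 0.
  have hbasis : ∀ {U : Y.base.Opens} {n : ℕ} (s : Fin n → Y.alg.Sections U), Y.alg.IsBasis s →
      ∀ {V : X.base.Opens} (h : V ≤ p.base ⁻¹ᵁ U) z, z ∈ G V → ∃ c : Fin n → Γ(X.base, V),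
        z = (∑ i, X.alg.algMap V (c i) * X.alg.res h (p.app U (s i)),
          ∑ i, c i • resM N h (φ' U (s i))) := by
    intro U n s hs V h z hz
    induction hz using AddSubgroup.closure_induction with
    | mem z hz =>
      obtain ⟨U', h', r, β, rfl⟩ := hz
      -- The section `β` lives over an open set `U'` unrelated to `U`, so it is expanded in the
      -- basis only over `U' ⊓ U`, whose preimage still contains `V`.
      obtain ⟨a, ha⟩ := (hs (U' ⊓ U) inf_le_right).2 (Y.alg.res inf_le_left β)
      have hV : V ≤ p.base ⁻¹ᵁ (U' ⊓ U) := le_inf h' h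
      refine ⟨fun i => r * resO hV (p.base.app _ (a i)), Prod.ext ?_ ?_⟩
      · have : X.alg.res h' (p.app U' β) = X.alg.res hV (p.app _ (Y.alg.res inf_le_left β)) := by
          rw [p.app_res, res_res]
        rw [this, ← ha]
        simp only [map_sum, map_mul, p.app_algMap, p.app_res, res_res, res_algMap, Finset.mul_sum,
          mul_assoc]
      · have : resM N h' (φ' U' β) = resM N hV (φ' _ (Y.alg.res inf_le_left β)) := by
          rw [φres, resM_comp]
        simp only
        rw [this, ← ha]
        simp only [map_sum, φmul, φres, resM_smul, resM_comp, Finset.smul_sum, mul_smul]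
    | zero => exact ⟨0, by simp; rfl⟩
    | add z z' _ _ hz hz' =>
      obtain ⟨c, rfl⟩ := hz
      obtain ⟨c', rfl⟩ := hz'
      exact ⟨c + c', by simp [add_mul, add_smul, Finset.sum_add_distrib]⟩
    | neg z _ hz =>
      obtain ⟨c, rfl⟩ := hz
      exact ⟨-c, by simp⟩
  have hres : ∀ {U V : X.base.Opens} (h : U ≤ V) {b t}, (b, t) ∈ G V →
      (X.alg.res h b, resM N h t) ∈ G U := by
    intro U V h b t hz
    have : ((X.alg.res h : _ →+ _).prodMap (resM N h)) (b, t) ∈ G U := by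
      generalize (b, t) = z at hz
      induction hz using AddSubgroup.closure_induction with
      | mem z hz =>
        obtain ⟨U', h', r, β, rfl⟩ := hz
        refine AddSubgroup.subset_closure ⟨U', h.trans h', resO h r, β, ?_⟩
        simp [res_algMap, res_res, resM_comp]
      | zero => rw [map_zero]; exact zero_mem _
      | add z z' _ _ hz hz' => rw [map_add]; exact add_mem hz hz'
      | neg z _ hz => rw [map_neg]; exact neg_mem hz
    exact this
  have hsmul : ∀ {V : X.base.Opens} (r : Γ(X.base, V)) {b t}, (b, t) ∈ G V →
      (X.alg.algMap V r * b, r • t) ∈ G V := by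
    intro V r b t hz
    have : ((AddMonoidHom.mulLeft (X.alg.algMap V r)).prodMap
        (DistribSMul.toAddMonoidHom Γ(N, V) r)) (b, t) ∈ G V := by
      generalize (b, t) = z at hz
      induction hz using AddSubgroup.closure_induction with
      | mem z hz =>
        obtain ⟨U', h', r', β, rfl⟩ := hz
        refine AddSubgroup.subset_closure ⟨U', h', r * r', β, ?_⟩
        simp [mul_smul, mul_assoc]
      | zero => rw [map_zero]; exact zero_mem _
      | add z z' _ _ hz hz' => rw [map_add]; exact add_mem hz hz'
      | neg z _ hz => rw [map_neg]; exact neg_mem hz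
    exact this
  have hzero : ∀ {V : X.base.Opens} {t}, (0, t) ∈ G V → t = 0 := by
    intro V t h
    refine modules_eq_of_locally fun x hx => ?_
    obtain ⟨U, hxU, n, s, hsY, hsX⟩ := hp x
    refine ⟨V ⊓ p.base ⁻¹ᵁ U, inf_le_left, ⟨hx, hxU⟩, ?_⟩
    obtain ⟨c, hc⟩ := hbasis s hsY inf_le_right _ (hres inf_le_left h)
    have h0 : c = 0 := (hsX _ inf_le_right).1 (by
      simpa [eq_comm] using congrArg Prod.fst hc)
    rw [map_zero]
    simpa [h0] using congrArg Prod.snd hc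
  have hex : ∀ {V : X.base.Opens} (b : X.alg.Sections V), ∀ x ∈ V, ∃ (W : X.base.Opens)
      (h : W ≤ V), x ∈ W ∧ ∃ t, (X.alg.res h b, t) ∈ G W := by
    intro V b x hx
    obtain ⟨U, hxU, n, s, hsY, hsX⟩ := hp x
    obtain ⟨c, hc⟩ := (hsX (V ⊓ p.base ⁻¹ᵁ U) inf_le_right).2 (X.alg.res inf_le_left b)
    refine ⟨V ⊓ p.base ⁻¹ᵁ U, inf_le_left, ⟨hx, hxU⟩,
      ∑ i, c i • resM N inf_le_right (φ' U (s i)), ?_⟩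
    rw [← hc]
    have := sum_mem (S := G (V ⊓ p.base ⁻¹ᵁ U)) (t := Finset.univ) fun i _ =>
      AddSubgroup.subset_closure (k := gens _) ⟨U, inf_le_right, c i, s i, rfl⟩
    exact (congrArg (· ∈ G _) (Prod.ext Prod.fst_sum Prod.snd_sum)).mp this
  obtain ⟨g, hg⟩ := exists_hom_of_graph G hres hsmul hzero hex
  have hgφ : ∀ g : X.alg.toModules ⟶ N,
      p.moduleMap ≫ (Scheme.Modules.pushforward p.base).map g = φ ↔
        ∀ U b, appHom g (p.base ⁻¹ᵁ U) (p.app U b) = φ' U b := fun g =>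
    ⟨fun h U b => congrArg (fun φ => appHom φ U b) h, fun h => hom_ext_appHom h⟩
  have hgφ' : ∀ U b, appHom g (p.base ⁻¹ᵁ U) (p.app U b) = φ' U b := fun U b =>
    hg _ _ _ (AddSubgroup.subset_closure ⟨U, le_rfl, 1, b, by simp [res_self, resM_id]⟩)
  -- Uniqueness: the sections `p(s i)` generate `B_X` locally, and the value on them is prescribed
  -- by `φ`.
  refine ⟨g, (hgφ g).2 hgφ', fun g' hg' => hom_ext_appHom fun V b => ?_⟩
  have hg' := (hgφ g').1 hg'
  refine modules_eq_of_locally fun x hx => ?_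
  obtain ⟨U, hxU, n, s, hsY, hsX⟩ := hp x
  obtain ⟨c, hc⟩ := (hsX (V ⊓ p.base ⁻¹ᵁ U) inf_le_right).2 (X.alg.res inf_le_left b)
  refine ⟨V ⊓ p.base ⁻¹ᵁ U, inf_le_left, ⟨hx, hxU⟩, ?_⟩
  rw [← appHom_res, ← appHom_res, ← hc]
  simp only [map_sum, appHom_mul, appHom_res, hg', hgφ']

/-- By Yoneda it suffices that composing with `p^* B_Y ⟶ B_X` is bijective on maps to every `N`.
Under adjunction, maps from `p^* B_Y` to `N` are maps from `B_Y` to `p_* N`, so this is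
`existsUnique`. -/
theorem Hom.HasLocalBases.isStrict {p : X ⟶ Y} (hp : Hom.HasLocalBases p) : IsStrict p := by
  refine isIso_iff_coyoneda_map_bijective _ |>.2 fun N => ?_
  let adj := Scheme.Modules.pullbackPushforwardAdjunction (Hom.base p)
  have h : ∀ g : X.alg.toModules ⟶ N, (adj.homEquiv _ _).symm (Hom.moduleMap p) ≫ g =
      (adj.homEquiv _ _).symm (Hom.moduleMap p ≫ (Scheme.Modules.pushforward _).map g) :=
    fun g => (adj.homEquiv_naturality_right_symm _ _).symm
  constructor
  · intro g g' hg
    have hg' := (adj.homEquiv _ _).symm.injective ((h g).symm.trans (hg.trans (h g')))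
    exact (hp.existsUnique _).unique rfl hg'.symm
  · intro φ
    obtain ⟨g, hg, -⟩ := hp.existsUnique (adj.homEquiv _ _ φ)
    exact ⟨g, (h g).trans ((congrArg _ hg).trans (Equiv.symm_apply_apply _ _))⟩

/-- Equal base morphisms need not have definitionally equal preimages, so the values are compared
through the restriction map between two equal open sets. -/
theorem Hom.ext_of_res {f g : X.Hom Y} (h : f.base = g.base)
    (happ : ∀ (U : Y.base.Opens) (b : Y.alg.Sections U),
      f.app U b = X.alg.res (by rw [h]) (g.app U b)) : f = g := by
  obtain ⟨fb, fa, _, _⟩ := f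
  obtain ⟨gb, ga, _, _⟩ := g
  obtain rfl : fb = gb := h
  congr 1
  funext U
  ext b
  exact (happ U b).trans (res_self _ _)

theorem Hom.app_eq_of_eq {f g : X.Hom Y} (h : f = g) (U : Y.base.Opens) (b : Y.alg.Sections U) :
    f.app U b = X.alg.res (by rw [h]) (g.app U b) := by
  subst h
  exact (res_self _ _).symm

/-- A morphism to a scheme is determined by the underlying morphism of schemes. -/
theorem hom_ofScheme_ext {S : Scheme.{u}} {f g : X ⟶ ofScheme S} (h : Hom.base f = Hom.base g) :
    f = g := by
  refine Hom.ext_of_res h fun U b => ?_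
  refine (Hom.app_algMap f U b).trans ?_
  refine Eq.trans ?_ (congrArg _ (Hom.app_algMap g U b)).symm
  rw [res_algMap]
  congr 1
  obtain ⟨fb, fa, _, _⟩ := f
  obtain ⟨gb, ga, _, _⟩ := g
  obtain rfl : fb = gb := h
  exact (resO_id _ _).symm

theorem mul_mul_mul_comm_of_central (B : AlgebraSheaf X.base) {U : X.base.Opens}
    (r r' : Γ(X.base, U)) (b b' : B.Sections U) :
    B.algMap U r * b * (B.algMap U r' * b') = B.algMap U (r * r') * (b * b') := by
  have : b * B.algMap U r' = B.algMap U r' * b := (B.central U r' b).eq.symm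
  rw [map_mul, mul_assoc, ← mul_assoc b, this]
  simp only [mul_assoc]

/-- A morphism to `Y` whose underlying morphism of schemes factors through `X` factors through
a morphism `X ⟶ Y` with local bases. -/
theorem Hom.HasLocalBases.exists_lift {p : X ⟶ Y} (hp : Hom.HasLocalBases p)
    (f : Z.base ⟶ X.base) (a : Z ⟶ Y) (h : Hom.base a = f ≫ Hom.base p) :
    ∃ m : Z ⟶ X, Hom.base m = f ∧ m ≫ p = a := by
  obtain ⟨ab, aapp, ares, aalg⟩ := a
  obtain rfl : ab = f ≫ Hom.base p := h
  -- The ring maps of `a` form a module map from `B_Y` to `p_* (f_* B_Z)`, which extends to `g : B_X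
  -- ⟶ f_* B_Z`. It remains to see that `g` is a map of algebras.
  let N : X.base.Modules := (Scheme.Modules.pushforward f).obj Z.alg.toModules
  obtain ⟨g, hg, -⟩ := hp.existsUnique (N := N)
    (homMk (fun U => (aapp U).toAddMonoidHom) (fun h b => ares h b) fun {U} r b => by
      refine ((aapp U).map_mul _ _).trans ?_
      rw [aalg]
      rfl)
  have hg : ∀ U b, appHom g ((Hom.base p) ⁻¹ᵁ U) (Hom.app p U b) = aapp U b := fun U b =>
    congrArg (fun φ => appHom φ U b) hg
  let g' (V : X.base.Opens) : X.alg.Sections V →+ Z.alg.Sections (f ⁻¹ᵁ V) := appHom g V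
  let a' (U : Y.base.Opens) : Y.alg.Sections U →+* Z.alg.Sections (f ⁻¹ᵁ (Hom.base p) ⁻¹ᵁ U) :=
    aapp U
  have hg' : ∀ U b, g' ((Hom.base p) ⁻¹ᵁ U) (Hom.app p U b) = a' U b := hg
  have gres : ∀ {U V : X.base.Opens} (h : U ≤ V) (b : X.alg.Sections V),
      g' U (X.alg.res h b) = Z.alg.res (f.preimage_mono h) (g' V b) := fun h b => appHom_res g h b
  have gmul : ∀ {U : X.base.Opens} (r : Γ(X.base, U)) (b : X.alg.Sections U),
      g' U (X.alg.algMap U r * b) = Z.alg.algMap _ (f.app U r) * g' U b :=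
    fun r b => appHom_mul g r b
  have gone : ∀ V, g' V 1 = 1 := fun V => by
    have := gres (V := (Hom.base p) ⁻¹ᵁ ⊤) (U := V) le_top (Hom.app p ⊤ 1)
    rw [hg', map_one, map_one (a' ⊤), map_one (Z.alg.res _)] at this
    exact (congrArg _ (map_one _).symm).trans this
  -- Multiplicativity is local. There both factors are combinations of sections coming from `B_Y`,
  -- on which `g'` agrees with the ring maps of `a`; the coefficients are central and can be moved
  -- to the front.
  have gmulmul : ∀ V b b', g' V (b * b') = g' V b * g' V b' := fun V b b' => by
    refine eq_of_locally _ fun x hx => ?_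
    obtain ⟨U, hxU, n, s, hsY, hsX⟩ := hp (f x)
    obtain ⟨c, hc⟩ := (hsX (V ⊓ (Hom.base p) ⁻¹ᵁ U) inf_le_right).2 (X.alg.res inf_le_left b)
    obtain ⟨c', hc'⟩ := (hsX (V ⊓ (Hom.base p) ⁻¹ᵁ U) inf_le_right).2 (X.alg.res inf_le_left b')
    refine ⟨f ⁻¹ᵁ (V ⊓ (Hom.base p) ⁻¹ᵁ U), f.preimage_mono inf_le_left, ⟨hx, hxU⟩, ?_⟩
    rw [map_mul (Z.alg.res _), ← gres inf_le_left, ← gres inf_le_left, ← gres inf_le_left,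
      map_mul (X.alg.res _), ← hc, ← hc']
    have hs : ∀ i j, g' (V ⊓ (Hom.base p) ⁻¹ᵁ U) (X.alg.res inf_le_right (Hom.app p U (s i)) *
        X.alg.res inf_le_right (Hom.app p U (s j))) =
        Z.alg.res (f.preimage_mono inf_le_right) (a' U (s i)) *
          Z.alg.res (f.preimage_mono inf_le_right) (a' U (s j)) := fun i j => by
      rw [← map_mul, ← map_mul, gres, hg', map_mul (a' U), map_mul (Z.alg.res _)]
    simp only [Finset.sum_mul_sum, map_sum, mul_mul_mul_comm_of_central, gmul, gres, hg', hs]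
    simp only [map_mul]
  refine ⟨⟨f, fun V => RingHom.mk' ⟨⟨g' V, gone V⟩, gmulmul V⟩ (g' V).map_add, gres,
    fun U r => ?_⟩, rfl, ?_⟩
  · have := gmul r 1
    rwa [mul_one, gone, mul_one] at this
  · refine Hom.ext_of_res rfl fun U b => ?_
    exact (hg' U b).trans (res_self _ _).symm

/-- Locally `B_X` is generated over functions by sections coming from `B_Y`. The base morphism
determines the images of functions, and the composite with `p` determines those of the other
generators. -/
theorem Hom.HasLocalBases.hom_ext {p : X ⟶ Y} (hp : Hom.HasLocalBases p) {m m' : Z ⟶ X}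
    (hbase : Hom.base m = Hom.base m') (h : m ≫ p = m' ≫ p) : m = m' := by
  obtain ⟨f, mapp, mres, malg⟩ := m
  obtain ⟨f', mapp', mres', malg'⟩ := m'
  obtain rfl : f = f' := hbase
  refine Hom.ext_of_res rfl fun V b => eq_of_locally _ fun x hx => ?_
  have hp' : ∀ U b, mapp ((Hom.base p) ⁻¹ᵁ U) (Hom.app p U b) =
      mapp' ((Hom.base p) ⁻¹ᵁ U) (Hom.app p U b) := fun U b =>
    (Hom.app_eq_of_eq h U b).trans (res_self _ _)
  obtain ⟨U, hxU, n, s, hsY, hsX⟩ := hp (f x)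
  obtain ⟨c, hc⟩ := (hsX (V ⊓ (Hom.base p) ⁻¹ᵁ U) inf_le_right).2 (X.alg.res inf_le_left b)
  refine ⟨f ⁻¹ᵁ (V ⊓ (Hom.base p) ⁻¹ᵁ U), f.preimage_mono inf_le_left, ⟨hx, hxU⟩, ?_⟩
  rw [res_self]
  change Z.alg.res _ (mapp V b) = Z.alg.res _ (mapp' V b)
  rw [← mres inf_le_left, ← mres' inf_le_left, ← hc]
  simp only [map_sum, map_mul, malg, malg', mres, mres', hp']

/-- A morphism to a scheme carries no algebra data beyond its base morphism. A cone is thus a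
morphism to `Y` together with a factorization of its base through that of `p`, which is the input of
`exists_lift`. -/
theorem Hom.HasLocalBases.isPullback {p : X ⟶ Y} (hp : Hom.HasLocalBases p) :
    IsPullback p X.toBase Y.toBase (ofHom (Hom.base p)) := by
  have w : p ≫ Y.toBase = X.toBase ≫ ofHom (Hom.base p) :=
    hom_ofScheme_ext ((Category.comp_id (Hom.base p)).trans (Category.id_comp (Hom.base p)).symm)
  have hbase : ∀ {W : NCScheme.{u}} (m : W ⟶ X), Hom.base (m ≫ X.toBase) = Hom.base m :=
    fun m => Category.comp_id (Hom.base m)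
  have hlift : ∀ s : Limits.PullbackCone Y.toBase (ofHom (Hom.base p)),
      ∃ m : s.pt ⟶ X, Hom.base m = Hom.base s.snd ∧ m ≫ p = s.fst := fun s =>
    hp.exists_lift (Hom.base (Y := ofScheme X.base) s.snd) s.fst
      ((Category.comp_id (Hom.base s.fst)).symm.trans 
        (by exact congrArg Hom.base s.condition))
  choose l hl₁ hl₂ using hlift
  exact ⟨⟨w⟩, ⟨Limits.PullbackCone.IsLimit.mk w l hl₂
    (fun s => hom_ofScheme_ext ((hbase _).trans (hl₁ s)))
    fun s m h₁ h₂ => hp.hom_ext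
      (((hbase m).symm.trans (congrArg Hom.base h₂)).trans (hl₁ s).symm)
      (h₁.trans (hl₂ s).symm)⟩⟩

end NCScheme

variable {n : ℕ}

/-! ### Functions on projective space -/

/-- The value of a function in the localization at a point. -/
def funcVal {U : (PSpace n).Opens} (r : Γ(PSpace n, U)) (x : U) : LocAt x.1 := (r.1 x).val

theorem func_ext {U : (PSpace n).Opens} {r r' : Γ(PSpace n, U)}
    (h : ∀ x, funcVal r x = funcVal r' x) : r = r' :=
  Subtype.ext (funext fun x => HomogeneousLocalization.val_injective _ (h x))

theorem funcVal_mul {U : (PSpace n).Opens} (r r' : Γ(PSpace n, U)) (x : U) :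
    funcVal (r * r') x = funcVal r x * funcVal r' x := HomogeneousLocalization.val_mul _ _

theorem funcVal_add {U : (PSpace n).Opens} (r r' : Γ(PSpace n, U)) (x : U) :
    funcVal (r + r') x = funcVal r x + funcVal r' x := HomogeneousLocalization.val_add _ _

theorem funcVal_res {U V : (PSpace n).Opens} (h : U ≤ V) (r : Γ(PSpace n, V)) (x : U) :
    funcVal (resO h r) x = funcVal r ⟨x.1, h x.2⟩ := rfl

/-- For twist 0 the local fractions have numerator and denominator of equal degree, so they
represent elements of the homogeneous localization. -/
theorem exists_func {U : (PSpace n).Opens} (s : ∀ x : U, LocAt x.1) (hs : IsTwistSection 0 s) :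
    ∃ r : Γ(PSpace n, U), ∀ x, funcVal r x = s x := by
  have key : ∀ x : U, ∃ V : (PSpace n).Opens, x.1 ∈ V ∧ ∃ h : V ≤ U, ∃ (i : ℕ)
      (a b : polyGrading n i), ∀ y : V, ∃ hb : b.1 ∉ ptIdeal y.1,
      s ⟨y.1, h y.2⟩ = (HomogeneousLocalization.mk (𝒜 := polyGrading n)
        (x := (ptIdeal y.1).primeCompl) ⟨i, a, b, hb⟩).val := by
    intro x
    obtain ⟨V, hxV, h, i, j, a, b, hij, ha, hb, H⟩ := hs x
    obtain rfl : i = j := by omega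
    refine ⟨V, hxV, h, i, ⟨a, ha⟩, ⟨b, hb⟩, fun y => ⟨(H y).1, ?_⟩⟩
    rw [HomogeneousLocalization.val_mk, Localization.mk_eq_mk', eq_comm,
      IsLocalization.mk'_eq_iff_eq_mul]
    exact (H y).2.symm
  choose V hxV h i a b H using key
  choose hb H using H
  -- The value at `x` uses the fraction chosen near `x`. It agrees with the fractions chosen near
  -- other points because the homogeneous localization embeds in the full localization.
  let r (x : U) : HomogeneousLocalization.AtPrime (polyGrading n) (ptIdeal x.1) :=
    HomogeneousLocalization.mk ⟨i x, a x, b x, hb x ⟨x.1, hxV x⟩⟩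
  have hr : ∀ x, (r x).val = s x := fun x => (H x ⟨x.1, hxV x⟩).symm
  refine ⟨⟨r, fun x => ⟨V x, hxV x, homOfLE (h x), i x, a x, b x, hb x, fun y => ?_⟩⟩, hr⟩
  exact HomogeneousLocalization.val_injective _ ((hr _).trans (H x y))

/-- The function with given values. -/
def funcMk {U : (PSpace n).Opens} (s : ∀ x : U, LocAt x.1) (hs : IsTwistSection 0 s) :
    Γ(PSpace n, U) := (exists_func s hs).choose

theorem funcVal_funcMk {U : (PSpace n).Opens} (s : ∀ x : U, LocAt x.1) (hs : IsTwistSection 0 s)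
    (x : U) : funcVal (funcMk s hs) x = s x := (exists_func s hs).choose_spec x

/-! ### The standard charts -/

/-- The open subset where a coordinate does not vanish. -/
def chart (j : Fin (n + 1)) : (PSpace n).Opens :=
  Proj.basicOpen (polyGrading n) (MvPolynomial.X j)

theorem mem_chart {j : Fin (n + 1)} {x : PSpace n} :
    x ∈ chart j ↔ MvPolynomial.X j ∉ ptIdeal x := Iff.rfl

/-- A prime containing all coordinates contains every monomial of positive degree, hence the
irrelevant ideal. -/
theorem exists_mem_chart (x : PSpace n) : ∃ j, x ∈ chart j := by
  by_contra! H
  refine ProjectiveSpectrum.not_irrelevant_le (𝒜 := polyGrading n) x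
    ((HomogeneousIdeal.toIdeal_irrelevant_le _).2 fun i hi p hp => ?_)
  change p ∈ ptIdeal x
  rw [p.as_sum]
  refine sum_mem fun m hm => ?_
  obtain ⟨j, hj⟩ : ∃ j, m j ≠ 0 := by
    by_contra! h
    have := (hp (MvPolynomial.mem_support_iff.1 hm) : _ = i)
    obtain rfl : m = 0 := Finsupp.ext h
    simp at this
    omega
  refine Ideal.mem_of_dvd _ ?_ (not_not.1 (H j))
  exact MvPolynomial.X_dvd_monomial.2 (Or.inr hj)

/-- The inverse of a coordinate. -/
def coordInv (j : Fin (n + 1)) (x : PSpace n) : LocAt x :=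
  -- Outside the chart the coordinate is not a unit and the value is 0; this lets the expression be
  -- written at every point.
  Ring.inverse (polyAt x (MvPolynomial.X j))

theorem polyAt_mul_coordInv {j : Fin (n + 1)} {x : PSpace n} (h : x ∈ chart j) :
    polyAt x (MvPolynomial.X j) * coordInv j x = 1 :=
  Ring.mul_inverse_cancel _ (IsLocalization.map_units (LocAt x)
    (⟨MvPolynomial.X j, h⟩ : (ptIdeal x).primeCompl))

theorem polyAt_pow_mul_coordInv_pow {j : Fin (n + 1)} {x : PSpace n} (h : x ∈ chart j) (w : ℕ) :
    polyAt x (MvPolynomial.X j) ^ w * coordInv j x ^ w = 1 := by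
  rw [← mul_pow, polyAt_mul_coordInv h, one_pow]

theorem IsTwistSection.coordInv_pow {j : Fin (n + 1)} {U : (PSpace n).Opens} (hU : U ≤ chart j)
    (w : ℕ) : IsTwistSection (-(w : ℤ)) fun x : U => coordInv j x.1 ^ w := fun x =>
  ⟨U, x.2, le_rfl, 0, w, 1, MvPolynomial.X j ^ w, by simp, MvPolynomial.isHomogeneous_one _ _,
    by simpa using (MvPolynomial.isHomogeneous_X ℂ j).pow w,
    fun y => ⟨fun h => hU y.2 ((isPrime_ptIdeal y.1).mem_of_pow_mem _ h), by
      rw [map_pow, mul_comm, polyAt_pow_mul_coordInv_pow (hU y.2), map_one]⟩⟩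

theorem IsTwistSection.coord_pow (j : Fin (n + 1)) (U : (PSpace n).Opens)
    (w : ℕ) : IsTwistSection (w : ℤ) fun x : U => polyAt x.1 (MvPolynomial.X j) ^ w := by
  have := IsTwistSection.poly (U := U) (p := MvPolynomial.X j ^ w) (m := w)
    (by simpa using (MvPolynomial.isHomogeneous_X ℂ j).pow w)
  simpa only [map_pow] using this

theorem IsTwistSection.of_locally {d : ℤ} {U : (PSpace n).Opens} {s : ∀ x : U, LocAt x.1}
    (h : ∀ x ∈ U, ∃ (V : (PSpace n).Opens) (hV : V ≤ U), x ∈ V ∧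
      IsTwistSection d fun y : V => s ⟨y.1, hV y.2⟩) : IsTwistSection d s :=
  (twistPredicate n d).locality s fun x => by
    obtain ⟨V, hV, hxV, H⟩ := h x.1 x.2
    exact ⟨V, hxV, homOfLE hV, H⟩

theorem IsTwistSection.restrict {d : ℤ} {U V : (PSpace n).Opens} {s : ∀ x : U, LocAt x.1}
    (hs : IsTwistSection d s) (h : V ≤ U) : IsTwistSection d fun y : V => s ⟨y.1, h y.2⟩ :=
  (twistPredicate n d).res (homOfLE h) s hs

theorem twistVal_twistMk {d : ℤ} {U : (PSpace n).Opens} (s : ∀ x : U, LocAt x.1)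
    (hs : IsTwistSection d s) (x : U) : twistVal (twistMk s hs) x = s x := rfl

theorem twistVal_smul' {d : ℤ} {U : (PSpace n).Opens} (r : Γ(PSpace n, U))
    (s : Γ(twist n d, U)) (x : U) : twistVal (r • s) x = funcVal r x * twistVal s x := rfl

/-- The generator `x_j^{-w}` of `𝒪(-w)` on a chart. -/
def twistGen (j : Fin (n + 1)) (w : ℕ) {U : (PSpace n).Opens} (hU : U ≤ chart j) :
    Γ(twist n (-(w : ℤ)), U) :=
  twistMk _ (IsTwistSection.coordInv_pow hU w)

/-- The coordinate of a section of `𝒪(-w)` with respect to `x_j^{-w}`. -/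
def twistCoord (j : Fin (n + 1)) (w : ℕ) {U : (PSpace n).Opens} (s : Γ(twist n (-(w : ℤ)), U)) :
    Γ(PSpace n, U) :=
  funcMk (fun x => polyAt x.1 (MvPolynomial.X j) ^ w * twistVal s x) (by
    have := (IsTwistSection.coord_pow j U w).mul (twistVal_mem s)
    rwa [add_neg_cancel] at this)

theorem twistCoord_smul_twistGen (j : Fin (n + 1)) (w : ℕ) {U : (PSpace n).Opens}
    (hU : U ≤ chart j) (s : Γ(twist n (-(w : ℤ)), U)) :
    twistCoord j w s • twistGen j w hU = s := twist_ext fun x => by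
  rw [twistVal_smul', twistCoord, funcVal_funcMk, twistGen, twistVal_twistMk, mul_right_comm,
    polyAt_pow_mul_coordInv_pow (hU x.2), one_mul]

theorem twistCoord_smul {j : Fin (n + 1)} {w : ℕ} {U : (PSpace n).Opens} (r : Γ(PSpace n, U))
    (s : Γ(twist n (-(w : ℤ)), U)) : twistCoord j w (r • s) = r * twistCoord j w s :=
  func_ext fun x => by
    rw [funcVal_mul, twistCoord, funcVal_funcMk, twistCoord, funcVal_funcMk, twistVal_smul',
      mul_left_comm]

theorem twistCoord_add {j : Fin (n + 1)} {w : ℕ} {U : (PSpace n).Opens}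
    (s t : Γ(twist n (-(w : ℤ)), U)) :
    twistCoord j w (s + t) = twistCoord j w s + twistCoord j w t :=
  func_ext fun x => by
    rw [funcVal_add, twistCoord, funcVal_funcMk, twistCoord, funcVal_funcMk, twistCoord,
      funcVal_funcMk, twistVal_add, mul_add]

theorem twistCoord_twistGen (j : Fin (n + 1)) (w : ℕ) {U : (PSpace n).Opens} (hU : U ≤ chart j) :
    twistCoord j w (twistGen j w hU) = 1 :=
  func_ext fun x => by
    rw [twistCoord, funcVal_funcMk, twistGen, twistVal_twistMk,
      polyAt_pow_mul_coordInv_pow (hU x.2)]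
    exact (HomogeneousLocalization.val_one).symm

/-! ### Bases of split bundles -/

section SplitBundle

variable {ι : Type} [Fintype ι] {w : ι → ℕ} {U : (PSpace n).Opens}

/-- The components of a section of a split bundle. -/
def bundleProj (w : ι → ℕ) (U : (PSpace n).Opens) (k : ι) :
    Γ(splitBundle n w, U) →ₗ[Γ(PSpace n, U)] Γ(twist n (-(w k : ℤ)), U) :=
  appLin (Limits.biproduct.π (fun k => twist n (-(w k : ℤ))) k) U

/-- The inclusion of a component of a split bundle. -/
def bundleIncl (w : ι → ℕ) (U : (PSpace n).Opens) (k : ι) :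
    Γ(twist n (-(w k : ℤ)), U) →ₗ[Γ(PSpace n, U)] Γ(splitBundle n w, U) :=
  appLin (Limits.biproduct.ι (fun k => twist n (-(w k : ℤ))) k) U

theorem bundleProj_incl_self (k : ι) (s : Γ(twist n (-(w k : ℤ)), U)) :
    bundleProj w U k (bundleIncl w U k s) = s :=
  congrArg (fun f : twist n (-(w k : ℤ)) ⟶ _ => appLin f U s)
    (Limits.biproduct.ι_π_self (fun k => twist n (-(w k : ℤ))) k)

theorem bundleProj_incl_ne {k l : ι} (h : k ≠ l) (s : Γ(twist n (-(w k : ℤ)), U)) :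
    bundleProj w U l (bundleIncl w U k s) = 0 :=
  congrArg (fun f : twist n (-(w k : ℤ)) ⟶ _ => appLin f U s)
    (Limits.biproduct.ι_π_ne (fun k => twist n (-(w k : ℤ))) h)

theorem sum_bundleIncl_proj (v : Γ(splitBundle n w, U)) :
    ∑ k, bundleIncl w U k (bundleProj w U k v) = v := by
  have h := congrArg (fun f : splitBundle n w ⟶ splitBundle n w => appLin f U v)
    (Limits.biproduct.total (f := fun k => twist n (-(w k : ℤ))))
  refine Eq.trans ?_ h
  let ev : (splitBundle n w ⟶ splitBundle n w) →+ Γ(splitBundle n w, U) :=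
    AddMonoidHom.mk' (fun f => appLin f U v) fun _ _ => rfl
  exact (map_sum ev (fun k => Limits.biproduct.π (fun k => twist n (-(w k : ℤ))) k ≫
    Limits.biproduct.ι (fun k => twist n (-(w k : ℤ))) k) Finset.univ).symm

theorem bundle_ext {v v' : Γ(splitBundle n w, U)}
    (h : ∀ k, bundleProj w U k v = bundleProj w U k v') : v = v' := by
  rw [← sum_bundleIncl_proj v, ← sum_bundleIncl_proj v']
  simp only [h]

theorem bundleProj_sum (s : ∀ k, Γ(twist n (-(w k : ℤ)), U)) (l : ι) :
    bundleProj w U l (∑ k, bundleIncl w U k (s k)) = s l := by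
  rw [map_sum, Finset.sum_eq_single l (fun k _ hk => bundleProj_incl_ne hk _) (by simp),
    bundleProj_incl_self]

/-- The standard frame of a split bundle on a chart. -/
def frame (w : ι → ℕ) (j : Fin (n + 1)) (hU : U ≤ chart j) (k : ι) : Γ(splitBundle n w, U) :=
  bundleIncl w U k (twistGen j (w k) hU)

/-- The coordinates of a section are `x_j^{w_k}` times its components, which are functions;
multiplying back by the generators `x_j^{-w_k}` is the inverse. -/
theorem exists_basis_frame (w : ι → ℕ) (j : Fin (n + 1)) (hU : U ≤ chart j) :
    ∃ b : Module.Basis ι Γ(PSpace n, U) Γ(splitBundle n w, U), ∀ k, b k = frame w j hU k := by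
  classical
  have hsum : ∀ c : ι → Γ(PSpace n, U), ∑ k, c k • frame w j hU k =
      ∑ k, bundleIncl w U k (c k • twistGen j (w k) hU) := fun c => by
    simp only [frame, map_smul]
  let e : Γ(splitBundle n w, U) ≃ₗ[Γ(PSpace n, U)] (ι → Γ(PSpace n, U)) :=
    { toFun := fun v k => twistCoord j (w k) (bundleProj w U k v)
      map_add' := fun v v' => funext fun k => by
        rw [map_add, twistCoord_add]; rfl
      map_smul' := fun r v => funext fun k => by
        rw [map_smul, twistCoord_smul]; rfl
      invFun := fun c => ∑ k, c k • frame w j hU k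
      left_inv := fun v => by
        refine (hsum _).trans ?_
        simp only [twistCoord_smul_twistGen, sum_bundleIncl_proj]
      right_inv := fun c => funext fun k => by
        beta_reduce
        rw [hsum, bundleProj_sum, twistCoord_smul, twistCoord_twistGen, mul_one] }
  refine ⟨Module.Basis.ofEquivFun e, fun k => ?_⟩
  rw [Module.Basis.coe_ofEquivFun]
  change ∑ l, (Pi.single k 1 : ι → Γ(PSpace n, U)) l • frame w j hU l = _
  rw [Finset.sum_eq_single k (fun l _ hl => by rw [Pi.single_eq_of_ne hl, zero_smul]) (by simp),
    Pi.single_eq_same, one_smul]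

theorem bundleProj_res {U V : (PSpace n).Opens} (h : U ≤ V) (k : ι) (v : Γ(splitBundle n w, V)) :
    bundleProj w U k (resM _ h v) = resM _ h (bundleProj w V k v) := appLin_res _ h v

theorem bundleIncl_res {U V : (PSpace n).Opens} (h : U ≤ V) (k : ι)
    (s : Γ(twist n (-(w k : ℤ)), V)) :
    bundleIncl w U k (resM _ h s) = resM _ h (bundleIncl w V k s) := appLin_res _ h s

theorem frame_res {U V : (PSpace n).Opens} (h : U ≤ V) (w : ι → ℕ) (j : Fin (n + 1))
    (hV : V ≤ chart j) (k : ι) :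
    resM _ h (frame w j hV k) = frame w j (h.trans hV) k :=
  (bundleIncl_res h k _).symm

end SplitBundle

/-! ### Sections of the dual of `𝒪(1)` -/

/-- Multiplication with a section of `𝒪(-1)`. -/
def mulTwist {U V : (PSpace n).Opens} (t : ∀ x : U, LocAt x.1) (ht : IsTwistSection (-1) t)
    (hV : V ≤ U) : Γ(twist n 1, V) →ₗ[Γ(PSpace n, V)] Γ(PSpace n, V) where
  toFun s := funcMk (fun x => t ⟨x.1, hV x.2⟩ * twistVal s x)
    ((ht.restrict hV).mul (twistVal_mem s))
  map_add' s s' := func_ext fun x => by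
    rw [funcVal_add, funcVal_funcMk, funcVal_funcMk, funcVal_funcMk, twistVal_add, mul_add]
  map_smul' r s := func_ext fun x => by
    rw [RingHom.id_apply, smul_eq_mul, funcVal_mul, funcVal_funcMk, funcVal_funcMk,
      twistVal_smul', mul_left_comm]

theorem funcVal_mulTwist {U V : (PSpace n).Opens} (t : ∀ x : U, LocAt x.1)
    (ht : IsTwistSection (-1) t) (hV : V ≤ U) (s : Γ(twist n 1, V)) (x : V) :
    funcVal (mulTwist t ht hV s) x = t ⟨x.1, hV x.2⟩ * twistVal s x :=
  funcVal_funcMk (fun y : V => t ⟨y.1, hV y.2⟩ * twistVal s y)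
    ((ht.restrict hV).mul (twistVal_mem s)) x

/-- The section of `𝒪(1)^*` given by multiplication with a section of `𝒪(-1)`. -/
def dualMk {U : (PSpace n).Opens} (t : ∀ x : U, LocAt x.1) (ht : IsTwistSection (-1) t) :
    DualSections (twist n 1) U :=
  ⟨fun V => mulTwist t ht V.2, fun _ _ h hW s => func_ext fun x =>
    (funcVal_mulTwist t ht (h.trans hW) (resM _ h s) x).trans
      (funcVal_mulTwist t ht hW s ⟨x.1, h x.2⟩).symm⟩

theorem funcVal_eval_dualMk {U V : (PSpace n).Opens} (t : ∀ x : U, LocAt x.1)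
    (ht : IsTwistSection (-1) t) (hV : V ≤ U) (s : Γ(twist n 1, V)) (x : V) :
    funcVal ((dualMk t ht).eval hV s) x = t ⟨x.1, hV x.2⟩ * twistVal s x :=
  funcVal_mulTwist t ht hV s x

/-- The coordinate `x_j` as a section of `𝒪(1)`. -/
def coordSection (j : Fin (n + 1)) (U : (PSpace n).Opens) : Γ(twist n 1, U) :=
  twistMk (fun x => polyAt x.1 (MvPolynomial.X j))
    (IsTwistSection.poly (MvPolynomial.isHomogeneous_X ℂ j))

/-- On its chart `x_j` generates `𝒪(1)`: the coefficient is `s / x_j`. -/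
theorem exists_smul_coordSection {j : Fin (n + 1)} {U : (PSpace n).Opens} (hU : U ≤ chart j)
    (s : Γ(twist n 1, U)) : ∃ r : Γ(PSpace n, U), (∀ x, funcVal r x = coordInv j x.1 * twistVal s x) ∧
      s = r • coordSection j U := by
  have h := (IsTwistSection.coordInv_pow hU 1).mul (twistVal_mem s)
  simp only [pow_one, Nat.cast_one, neg_add_cancel] at h
  refine ⟨funcMk _ h, funcVal_funcMk _ h, twist_ext fun x => ?_⟩
  rw [twistVal_smul', funcVal_funcMk]
  refine Eq.trans ?_ (mul_right_comm _ _ _)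
  refine (one_mul (twistVal s x)).symm.trans (congrArg (· * _) ?_)
  exact (polyAt_mul_coordInv (hU x.2)).symm.trans (mul_comm _ _)

/-- The value at a point of a section of `𝒪(1)^*`, seen as a section of `𝒪(-1)`. -/
def dualVal {U : (PSpace n).Opens} (φ : DualSections (twist n 1) U) (x : U) : LocAt x.1 :=
  -- The value is `φ(x_j) / x_j` for a coordinate chosen separately at each point; `funcVal_eval`
  -- shows that the choice is immaterial.
  coordInv (exists_mem_chart x.1).choose x.1 *
    funcVal (φ.eval inf_le_left (coordSection (exists_mem_chart x.1).choose
      (U ⊓ chart (exists_mem_chart x.1).choose))) ⟨x.1, x.2, (exists_mem_chart x.1).choose_spec⟩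

/-- Writing `s = (s / x_j) x_j` near the point and using linearity, evaluation of `φ` becomes
multiplication by `φ(x_j) / x_j`. This identifies the dual of `𝒪(1)` with `𝒪(-1)` pointwise. -/
theorem funcVal_eval {U V : (PSpace n).Opens} (φ : DualSections (twist n 1) U) (hV : V ≤ U)
    (s : Γ(twist n 1, V)) (x : V) :
    funcVal (φ.eval hV s) x = dualVal φ ⟨x.1, hV x.2⟩ * twistVal s x := by
  set j := (exists_mem_chart x.1).choose with hj
  have hxj : x.1 ∈ chart j := (exists_mem_chart x.1).choose_spec
  obtain ⟨r, hr, hs⟩ := exists_smul_coordSection (U := V ⊓ chart j) inf_le_right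
    (resM _ inf_le_left s)
  have h₁ : funcVal (φ.eval hV s) x =
      funcVal (φ.eval (inf_le_left.trans hV) (resM _ (inf_le_left : V ⊓ chart j ≤ V) s))
        ⟨x.1, x.2, hxj⟩ := by
    rw [φ.eval_res inf_le_left hV]; rfl
  have h₂ : funcVal (φ.eval (inf_le_left.trans hV) (coordSection j (V ⊓ chart j)))
      ⟨x.1, x.2, hxj⟩ = funcVal (φ.eval inf_le_left (coordSection j (U ⊓ chart j)))
        ⟨x.1, hV x.2, hxj⟩ := by
    have := φ.eval_res (inf_le_inf_right (chart j) hV) inf_le_left (coordSection j (U ⊓ chart j))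
    exact congrArg (fun r : Γ(PSpace n, V ⊓ chart j) => funcVal r ⟨x.1, x.2, hxj⟩) this
  rw [h₁, hs, map_smul, smul_eq_mul, funcVal_mul, hr, h₂, mul_right_comm]
  rfl

theorem isTwistSection_dualVal {U : (PSpace n).Opens} (φ : DualSections (twist n 1) U) :
    IsTwistSection (-1) (dualVal φ) := by
  refine IsTwistSection.of_locally fun x hx => ?_
  obtain ⟨j, hj⟩ := exists_mem_chart x
  -- Near `x` one fixed index `j` replaces the pointwise choice in `dualVal`, which exhibits the
  -- value as a product of sections of `𝒪(-1)` and `𝒪(0)`.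
  refine ⟨U ⊓ chart j, inf_le_left, ⟨hx, hj⟩, ?_⟩
  have h := (IsTwistSection.coordInv_pow (inf_le_right : U ⊓ chart j ≤ chart j) 1).mul
    (IsTwistSection.ofFunction (φ.eval inf_le_left (coordSection j (U ⊓ chart j))))
  simp only [pow_one, Nat.cast_one, add_zero] at h
  convert h using 1
  funext y
  refine Eq.trans ?_ (congrArg (coordInv j y.1 * ·) (funcVal_eval φ inf_le_left _ y)).symm
  refine (one_mul _).symm.trans ((congrArg (· * _)
    (polyAt_mul_coordInv (y.2.2 : y.1 ∈ chart j)).symm).trans ?_)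
  rw [mul_comm (polyAt _ _), mul_assoc, mul_comm (polyAt _ _)]
  rfl

/-- Testing on a coordinate that is invertible at the point and cancelling it recovers the value. -/
theorem dualVal_eq_of_funcVal {U : (PSpace n).Opens} {φ : DualSections (twist n 1) U} {x : U}
    {a : LocAt x.1} (h : ∀ (V : (PSpace n).Opens) (hV : V ≤ U) (hx : x.1 ∈ V) (s : Γ(twist n 1, V)),
      funcVal (φ.eval hV s) ⟨x.1, hx⟩ = a * twistVal s ⟨x.1, hx⟩) : dualVal φ x = a := by
  obtain ⟨j, hj⟩ := exists_mem_chart x.1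
  have h₁ := h U le_rfl x.2 (coordSection j U)
  rw [funcVal_eval] at h₁
  have h₂ := congrArg (· * coordInv j x.1) h₁
  change dualVal φ x * polyAt x.1 (MvPolynomial.X j) * coordInv j x.1 =
    a * polyAt x.1 (MvPolynomial.X j) * coordInv j x.1 at h₂
  rwa [mul_assoc, mul_assoc, polyAt_mul_coordInv hj, mul_one, mul_one] at h₂

theorem dualVal_dualMk {U : (PSpace n).Opens} (t : ∀ x : U, LocAt x.1)
    (ht : IsTwistSection (-1) t) (x : U) : dualVal (dualMk t ht) x = t x :=
  dualVal_eq_of_funcVal fun _ hV hx s => funcVal_eval_dualMk t ht hV s ⟨x.1, hx⟩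

theorem dual_ext {U : (PSpace n).Opens} {φ ψ : DualSections (twist n 1) U}
    (h : ∀ x, dualVal φ x = dualVal ψ x) : φ = ψ :=
  DualSections.ext fun V hV s => func_ext fun x => by rw [funcVal_eval, funcVal_eval, h]

theorem dualVal_add {U : (PSpace n).Opens} (φ ψ : DualSections (twist n 1) U) (x : U) :
    dualVal (φ + ψ) x = dualVal φ x + dualVal ψ x :=
  dualVal_eq_of_funcVal fun V hV hx s => by
    rw [DualSections.eval_add, LinearMap.add_apply, funcVal_add, funcVal_eval, funcVal_eval,
      add_mul]

theorem dualVal_smul {U : (PSpace n).Opens} (r : Γ(PSpace n, U)) (φ : DualSections (twist n 1) U)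
    (x : U) : dualVal (r • φ) x = funcVal r x * dualVal φ x :=
  dualVal_eq_of_funcVal fun V hV hx s => by
    rw [DualSections.eval_smul, LinearMap.smul_apply, smul_eq_mul, funcVal_mul, funcVal_eval,
      funcVal_res, mul_assoc]

theorem dualVal_res {U V : (PSpace n).Opens} (h : U ≤ V) (φ : DualSections (twist n 1) V) (x : U) :
    dualVal (DualSections.res h φ) x = dualVal φ ⟨x.1, h x.2⟩ :=
  dualVal_eq_of_funcVal fun W hW hx s => by
    rw [DualSections.eval_resD, funcVal_eval]

/-- The generator `x_j^{-1}` of `𝒪(1)^*` on a chart. -/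
def dualGen (j : Fin (n + 1)) {U : (PSpace n).Opens} (hU : U ≤ chart j) :
    DualSections (twist n 1) U :=
  dualMk (fun x => coordInv j x.1) (by simpa using IsTwistSection.coordInv_pow hU 1)

theorem dualVal_dualGen (j : Fin (n + 1)) {U : (PSpace n).Opens} (hU : U ≤ chart j) (x : U) :
    dualVal (dualGen j hU) x = coordInv j x.1 := dualVal_dualMk _ _ x

theorem dualGen_res {U V : (PSpace n).Opens} (h : U ≤ V) (j : Fin (n + 1)) (hV : V ≤ chart j) :
    DualSections.res h (dualGen j hV) = dualGen j (h.trans hV) :=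
  dual_ext fun x => by rw [dualVal_res, dualVal_dualGen, dualVal_dualGen]

theorem dualGen_bijective (j : Fin (n + 1)) {U : (PSpace n).Opens} (hU : U ≤ chart j) :
    Function.Bijective fun r : Γ(PSpace n, U) => r • dualGen j hU := by
  constructor
  · intro r r' h
    refine func_ext fun x => ?_
    have := congrArg (fun φ => dualVal φ x * polyAt x.1 (MvPolynomial.X j)) h
    simpa only [dualVal_smul, dualVal_dualGen, mul_assoc, mul_comm (coordInv j x.1),
      polyAt_mul_coordInv (hU x.2), mul_one] using this
  · intro φ
    refine ⟨φ.eval le_rfl (coordSection j U), dual_ext fun x => ?_⟩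
    rw [dualVal_smul, dualVal_dualGen, funcVal_eval]
    change dualVal φ x * polyAt x.1 (MvPolynomial.X j) * coordInv j x.1 = _
    rw [mul_assoc, polyAt_mul_coordInv (hU x.2), mul_one]

/-! ### Pullback along the inclusion of a hyperplane -/

/-- The map of local rings induced by the inclusion of a hyperplane. -/
def locMap (x : PSpace n) : LocAt (hyperplaneInclusion n x) →+* LocAt x :=
  Localization.localRingHom (ptIdeal (hyperplaneInclusion n x)) (ptIdeal x)
    (killLast n : PolyRing (n + 1) →+* PolyRing n) rfl

theorem locMap_polyAt (x : PSpace n) (p : PolyRing (n + 1)) :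
    locMap x (polyAt (hyperplaneInclusion n x) p) = polyAt x (killLast n p) :=
  Localization.localRingHom_to_map _ _ _ _ p

/-- The ideal of the image point is by definition the preimage under `killLast`. -/
theorem killLast_notMem {x : PSpace n} {p : PolyRing (n + 1)}
    (h : p ∉ ptIdeal (hyperplaneInclusion n x)) : killLast n p ∉ ptIdeal x := h

theorem killLast_homogeneous {d : ℕ} {p : PolyRing (n + 1)} (h : p.IsHomogeneous d) :
    (killLast n p).IsHomogeneous d := (killLast n).map_mem h

/-- A local fraction `a / b` pulls back to the fraction of the images under `killLast`, which
preserves degrees and keeps the denominator outside the ideal. -/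
theorem IsTwistSection.pullback {d : ℤ} {U : (PSpace (n + 1)).Opens} {s : ∀ x : U, LocAt x.1}
    (hs : IsTwistSection d s) : IsTwistSection (U := hyperplaneInclusion n ⁻¹ᵁ U) d
      fun x => locMap x.1 (s ⟨hyperplaneInclusion n x.1, x.2⟩) := fun x => by
  obtain ⟨V, hxV, hV, i, j, a, b, hij, ha, hb, H⟩ := hs ⟨hyperplaneInclusion n x.1, x.2⟩
  refine ⟨hyperplaneInclusion n ⁻¹ᵁ V, hxV, (hyperplaneInclusion n).preimage_mono hV, i, j,
    killLast n a, killLast n b, hij, killLast_homogeneous ha, killLast_homogeneous hb, fun y => ?_⟩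
  obtain ⟨hb, h⟩ := H ⟨hyperplaneInclusion n y.1, y.2⟩
  refine ⟨killLast_notMem hb, ?_⟩
  rw [← locMap_polyAt, ← locMap_polyAt, ← h, map_mul]

theorem funcVal_app {U : (PSpace (n + 1)).Opens} (r : Γ(PSpace (n + 1), U))
    (x : ↥(hyperplaneInclusion n ⁻¹ᵁ U)) : funcVal ((hyperplaneInclusion n).app U r) x =
      locMap x.1 (funcVal r ⟨hyperplaneInclusion n x.1, x.2⟩) :=
  HomogeneousLocalization.val_localRingHom _

theorem killLast_X_castSucc (j : Fin (n + 1)) :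
    killLast n (MvPolynomial.X j.castSucc) = MvPolynomial.X j := by
  have := killLast_rename n (MvPolynomial.X j)
  rwa [MvPolynomial.rename_X] at this

theorem mem_chart_castSucc {j : Fin (n + 1)} {x : PSpace n} :
    hyperplaneInclusion n x ∈ chart j.castSucc ↔ x ∈ chart j := by
  rw [mem_chart, mem_chart, ← killLast_X_castSucc (n := n) j]
  exact Iff.rfl

theorem preimage_le_chart {U : (PSpace (n + 1)).Opens} {j : Fin (n + 1)}
    (hU : U ≤ chart j.castSucc) : hyperplaneInclusion n ⁻¹ᵁ U ≤ chart j :=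
  fun _ hx => mem_chart_castSucc.1 (hU hx)

theorem locMap_coordInv {j : Fin (n + 1)} {x : PSpace n} (hx : x ∈ chart j) :
    locMap x (coordInv j.castSucc (hyperplaneInclusion n x)) = coordInv j x := by
  have h := congrArg (locMap x) (polyAt_mul_coordInv (mem_chart_castSucc.2 hx))
  rw [map_mul, map_one, locMap_polyAt, killLast_X_castSucc] at h
  exact left_inv_eq_right_inv ((mul_comm _ _).trans h) (polyAt_mul_coordInv hx)

/-- Pullback of sections of `𝒪(d)`. -/
def twistPull {d : ℤ} {U : (PSpace (n + 1)).Opens} (s : Γ(twist (n + 1) d, U)) :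
    Γ(twist n d, hyperplaneInclusion n ⁻¹ᵁ U) :=
  twistMk _ (twistVal_mem s).pullback

theorem twistVal_twistPull {d : ℤ} {U : (PSpace (n + 1)).Opens} (s : Γ(twist (n + 1) d, U))
    (x : ↥(hyperplaneInclusion n ⁻¹ᵁ U)) : twistVal (twistPull s) x =
      locMap x.1 (twistVal s ⟨hyperplaneInclusion n x.1, x.2⟩) := rfl

theorem twistPull_add {d : ℤ} {U : (PSpace (n + 1)).Opens} (s t : Γ(twist (n + 1) d, U)) :
    twistPull (s + t) = twistPull s + twistPull t := twist_ext fun x => by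
  simp only [twistVal_add, twistVal_twistPull, map_add]

theorem twistPull_smul {d : ℤ} {U : (PSpace (n + 1)).Opens} (r : Γ(PSpace (n + 1), U))
    (s : Γ(twist (n + 1) d, U)) :
    twistPull (r • s) = (hyperplaneInclusion n).app U r • twistPull s := twist_ext fun x => by
  rw [twistVal_twistPull, twistVal_smul', twistVal_smul', map_mul, funcVal_app, twistVal_twistPull]

theorem twistPull_res {d : ℤ} {U V : (PSpace (n + 1)).Opens} (h : U ≤ V)
    (s : Γ(twist (n + 1) d, V)) : twistPull (resM _ h s) =
      resM _ ((hyperplaneInclusion n).preimage_mono h) (twistPull s) := rfl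

theorem twistPull_polyMul {m : ℕ} {d e c : ℤ} {p : PolyRing (n + 1)} (hp : p.IsHomogeneous m)
    {p' : PolyRing n} (hp' : p'.IsHomogeneous m) (hpp : killLast n p = p')
    (h : m + d + e = c) (U : (PSpace (n + 1)).Opens) (s : Γ(twist (n + 1) d, U))
    (t : Γ(twist (n + 1) e, U)) : twistPull (polyMul p hp h U s t) =
      polyMul p' hp' h _ (twistPull s) (twistPull t) := twist_ext fun x => by
  refine (map_mul (locMap x.1) _ _).trans (congrArg (· * _) ?_)
  refine (map_mul (locMap x.1) _ _).trans (congrArg (· * _) ?_)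
  rw [locMap_polyAt, hpp]

theorem twistPull_twistGen (j : Fin (n + 1)) (w : ℕ) {U : (PSpace (n + 1)).Opens}
    (hU : U ≤ chart j.castSucc) :
    twistPull (twistGen j.castSucc w hU) = twistGen j w (preimage_le_chart hU) :=
  twist_ext fun x => (map_pow (locMap x.1) _ _).trans
    (congrArg (· ^ w) (locMap_coordInv (preimage_le_chart hU x.2)))

/-- Pullback of sections of `𝒪(1)^*`. -/
def dualPull {U : (PSpace (n + 1)).Opens} (φ : DualSections (twist (n + 1) 1) U) :
    DualSections (twist n 1) (hyperplaneInclusion n ⁻¹ᵁ U) :=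
  dualMk _ (isTwistSection_dualVal φ).pullback

theorem dualVal_dualPull {U : (PSpace (n + 1)).Opens} (φ : DualSections (twist (n + 1) 1) U)
    (x : ↥(hyperplaneInclusion n ⁻¹ᵁ U)) : dualVal (dualPull φ) x =
      locMap x.1 (dualVal φ ⟨hyperplaneInclusion n x.1, x.2⟩) := dualVal_dualMk _ _ _

theorem dualPull_add {U : (PSpace (n + 1)).Opens} (φ ψ : DualSections (twist (n + 1) 1) U) :
    dualPull (φ + ψ) = dualPull φ + dualPull ψ := dual_ext fun x => by
  simp only [dualVal_add, dualVal_dualPull, map_add]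

theorem dualPull_smul {U : (PSpace (n + 1)).Opens} (r : Γ(PSpace (n + 1), U))
    (φ : DualSections (twist (n + 1) 1) U) :
    dualPull (r • φ) = (hyperplaneInclusion n).app U r • dualPull φ := dual_ext fun x => by
  rw [dualVal_dualPull, dualVal_smul, dualVal_smul, map_mul, funcVal_app, dualVal_dualPull]

theorem dualPull_res {U V : (PSpace (n + 1)).Opens} (h : U ≤ V)
    (φ : DualSections (twist (n + 1) 1) V) : dualPull (DualSections.res h φ) =
      DualSections.res ((hyperplaneInclusion n).preimage_mono h) (dualPull φ) :=
  dual_ext fun x => by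
    rw [dualVal_dualPull, dualVal_res, dualVal_res, dualVal_dualPull]

theorem dualPull_dualGen (j : Fin (n + 1)) {U : (PSpace (n + 1)).Opens}
    (hU : U ≤ chart j.castSucc) :
    dualPull (dualGen j.castSucc hU) = dualGen j (preimage_le_chart hU) := dual_ext fun x => by
  rw [dualVal_dualPull, dualVal_dualGen, dualVal_dualGen,
    locMap_coordInv (preimage_le_chart hU x.2)]

/-- On values the pairing of `𝒪(1)^*` with `𝒪(1)` is multiplication, which the ring map `locMap`
respects. -/
theorem eval_dualPull {U : (PSpace (n + 1)).Opens} (φ : DualSections (twist (n + 1) 1) U)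
    (s : Γ(twist (n + 1) 1, U)) : (dualPull φ).eval le_rfl (twistPull s) =
      (hyperplaneInclusion n).app U (φ.eval le_rfl s) := func_ext fun x => by
  rw [funcVal_eval, funcVal_app, funcVal_eval, dualVal_dualPull, twistVal_twistPull, map_mul]

section SplitBundle

variable {ι : Type} [Fintype ι] {w : ι → ℕ}

/-- Pullback of sections of a split bundle. -/
def bundlePull {U : (PSpace (n + 1)).Opens} (v : Γ(splitBundle (n + 1) w, U)) :
    Γ(splitBundle n w, hyperplaneInclusion n ⁻¹ᵁ U) :=
  ∑ k, bundleIncl w _ k (twistPull (bundleProj w U k v))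

theorem bundleProj_bundlePull {U : (PSpace (n + 1)).Opens} (v : Γ(splitBundle (n + 1) w, U))
    (k : ι) : bundleProj w _ k (bundlePull v) = twistPull (bundleProj w U k v) :=
  bundleProj_sum _ k

theorem bundlePull_add {U : (PSpace (n + 1)).Opens} (v v' : Γ(splitBundle (n + 1) w, U)) :
    bundlePull (v + v') = bundlePull v + bundlePull v' := bundle_ext fun k => by
  simp only [map_add, bundleProj_bundlePull, twistPull_add]

theorem bundlePull_smul {U : (PSpace (n + 1)).Opens} (r : Γ(PSpace (n + 1), U))
    (v : Γ(splitBundle (n + 1) w, U)) :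
    bundlePull (r • v) = (hyperplaneInclusion n).app U r • bundlePull v := bundle_ext fun k => by
  rw [bundleProj_bundlePull, map_smul, map_smul, twistPull_smul, bundleProj_bundlePull]

theorem bundlePull_res {U V : (PSpace (n + 1)).Opens} (h : U ≤ V)
    (v : Γ(splitBundle (n + 1) w, V)) : bundlePull (resM _ h v) =
      resM _ ((hyperplaneInclusion n).preimage_mono h) (bundlePull v) := bundle_ext fun k => by
  rw [bundleProj_bundlePull, bundleProj_res, bundleProj_res, twistPull_res, bundleProj_bundlePull]

theorem bundlePull_frame (j : Fin (n + 1)) {U : (PSpace (n + 1)).Opens}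
    (hU : U ≤ chart j.castSucc) (k : ι) :
    bundlePull (frame w j.castSucc hU k) = frame w j (preimage_le_chart hU) k :=
  bundle_ext fun l => by
    rw [bundleProj_bundlePull, frame, frame]
    rcases eq_or_ne k l with rfl | h
    · rw [bundleProj_incl_self, bundleProj_incl_self, twistPull_twistGen]
    · rw [bundleProj_incl_ne h, bundleProj_incl_ne h]
      exact twist_ext fun x => map_zero (locMap x.1)

theorem twistPull_matrixForm {M : Matrix ι ι (PolyRing (n + 1))}
    (hM : ∀ k l, (M k l).IsHomogeneous (w k + w l + 1)) {M' : Matrix ι ι (PolyRing n)}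
    (hM' : ∀ k l, (M' k l).IsHomogeneous (w k + w l + 1)) (h : ∀ k l, killLast n (M k l) = M' k l)
    {U : (PSpace (n + 1)).Opens} (v : Γ(splitBundle (n + 1) w, U)) :
    twistPull ((matrixForm w M hM).form U v) = (matrixForm w M' hM').form _ (bundlePull v) := by
  have happ : ∀ {m : ℕ} (N : Matrix ι ι (PolyRing m))
      (hN : ∀ k l, (N k l).IsHomogeneous (w k + w l + 1)) (U : (PSpace m).Opens)
      (v : Γ(splitBundle m w, U)), (matrixForm w N hN).form U v =
      ∑ k, ∑ l, polyMul (N k l) (hN k l) (weight_sum (w k) (w l)) U (bundleProj w U k v)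
        (bundleProj w U l v) := fun N hN U v => by
    simp only [matrixForm, LinearMap.BilinMap.toQuadraticMap_apply, LinearMap.sum_apply]
    rfl
  let T : Γ(twist (n + 1) 1, U) →+ Γ(twist n 1, hyperplaneInclusion n ⁻¹ᵁ U) :=
    AddMonoidHom.mk' twistPull twistPull_add
  rw [happ, happ]
  change T _ = _
  rw [map_sum]
  refine Finset.sum_congr rfl fun k _ => ?_
  rw [map_sum]
  refine Finset.sum_congr rfl fun l _ => ?_
  rw [bundleProj_bundlePull, bundleProj_bundlePull]
  exact twistPull_polyMul (hM k l) (hM' k l) (h k l) _ U _ _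

end SplitBundle

/-! ### Functoriality of the even Clifford algebra -/

/-- A map of quadratic forms over a morphism of schemes `f : X ⟶ Y`: semilinear maps on the
sections of `E` and of `L^*` which are compatible with the quadratic forms. -/
structure ModuleQuadraticForm.Pullback {X Y : Scheme.{u}} (f : X ⟶ Y) {E L : Y.Modules}
    {E' L' : X.Modules} (q : ModuleQuadraticForm E L) (q' : ModuleQuadraticForm E' L') where
  /-- the map on sections of `E` -/
  e (U : Y.Opens) : Γ(E, U) →+ Γ(E', f ⁻¹ᵁ U)
  /-- the map on sections of `L^*` -/
  d (U : Y.Opens) : DualSections L U →+ DualSections L' (f ⁻¹ᵁ U)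
  e_smul : ∀ {U : Y.Opens} (r : Γ(Y, U)) (v : Γ(E, U)), e U (r • v) = f.app U r • e U v
  d_smul : ∀ {U : Y.Opens} (r : Γ(Y, U)) (φ : DualSections L U), d U (r • φ) = f.app U r • d U φ
  e_res : ∀ {U V : Y.Opens} (h : U ≤ V) (v : Γ(E, V)),
    e U (resM E h v) = resM E' (f.preimage_mono h) (e V v)
  d_res : ∀ {U V : Y.Opens} (h : U ≤ V) (φ : DualSections L V),
    d U (DualSections.res h φ) = DualSections.res (f.preimage_mono h) (d V φ)
  eval_form : ∀ {U : Y.Opens} (φ : DualSections L U) (v : Γ(E, U)),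
    (d U φ).eval le_rfl (q'.form _ (e U v)) = f.app U (φ.eval le_rfl (q.form U v))

namespace ModuleQuadraticForm.Pullback

open PreSections

variable {X Y : Scheme.{u}} {f : X ⟶ Y} {E L : Y.Modules} {E' L' : X.Modules}
  {q : ModuleQuadraticForm E L} {q' : ModuleQuadraticForm E' L'} (P : Pullback f q q')

/-- The induced map on sections of the presheaves defining the even Clifford algebras. -/
theorem exists_map (U : Y.Opens) : ∃ g : q.PreSections U →+* q'.PreSections (f ⁻¹ᵁ U),
    (∀ r, g (algebraMap _ _ r) = algebraMap _ _ (f.app U r)) ∧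
      ∀ u v φ, g (gen q u v φ) = gen q' (P.e U u) (P.e U v) (P.d U φ) := by
  let _ : Algebra Γ(Y, U) (q'.PreSections (f ⁻¹ᵁ U)) := Algebra.compHom _ (f.app U).hom
  let γ : q.Gen U →ₗ[Γ(Y, U)] q'.PreSections (f ⁻¹ᵁ U) := TensorProduct.lift
    { toFun := fun u => TensorProduct.lift (LinearMap.mk₂ Γ(Y, U)
        (fun v φ => gen q' (P.e U u) (P.e U v) (P.d U φ))
        (fun v v' φ => by rw [map_add, gen_add_mid])
        (fun r v φ => by rw [P.e_smul, gen_smul_mid]; rfl)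
        (fun v φ φ' => by rw [map_add, gen_add_right])
        (fun r v φ => by rw [P.d_smul, gen_smul_right]; rfl))
      map_add' := fun u u' => by
        refine TensorProduct.ext' fun v φ => ?_
        simp only [TensorProduct.lift.tmul, LinearMap.mk₂_apply, LinearMap.add_apply, map_add,
          gen_add_left]
      map_smul' := fun r u => by
        refine TensorProduct.ext' fun v φ => ?_
        simp only [TensorProduct.lift.tmul, LinearMap.mk₂_apply, LinearMap.smul_apply,
          RingHom.id_apply, P.e_smul, gen_smul_left]
        rfl }
  have hγ : ∀ u v φ, γ (u ⊗ₜ (v ⊗ₜ φ)) = gen q' (P.e U u) (P.e U v) (P.d U φ) :=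
    fun u v φ => rfl
  let g : q.PreSections U →ₐ[Γ(Y, U)] q'.PreSections (f ⁻¹ᵁ U) :=
    RingQuot.liftAlgHom Γ(Y, U) (s := q.Rel U) ⟨TensorAlgebra.lift Γ(Y, U) γ, by
      intro x y hxy
      induction hxy with
      | contract v φ =>
        rw [TensorAlgebra.lift_ι_apply, hγ, AlgHom.commutes, gen_contract, P.eval_form]
        rfl
      | contract_mid u v w φ ψ =>
        rw [map_mul, map_smul, TensorAlgebra.lift_ι_apply, TensorAlgebra.lift_ι_apply,
          TensorAlgebra.lift_ι_apply, hγ, hγ, hγ, gen_contract_mid, P.eval_form]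
        rfl⟩
  exact ⟨g, fun r => g.commutes r, fun u v φ =>
    (RingQuot.liftAlgHom_mkAlgHom_apply Γ(Y, U) _ _ _).trans
      ((TensorAlgebra.lift_ι_apply _ _).trans (hγ u v φ))⟩

/-- The induced map on sections of the presheaves defining the even Clifford algebras. -/
def map (U : Y.Opens) : q.PreSections U →+* q'.PreSections (f ⁻¹ᵁ U) := (P.exists_map U).choose

theorem map_algebraMap (U : Y.Opens) (r : Γ(Y, U)) :
    P.map U (algebraMap _ _ r) = algebraMap _ _ (f.app U r) := (P.exists_map U).choose_spec.1 r

theorem map_gen {U : Y.Opens} (u v : Γ(E, U)) (φ : DualSections L U) :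
    P.map U (gen q u v φ) = gen q' (P.e U u) (P.e U v) (P.d U φ) :=
  (P.exists_map U).choose_spec.2 u v φ

theorem map_res {U V : Y.Opens} (h : U ≤ V) (a : q.PreSections V) :
    P.map U (res h a) = res (f.preimage_mono h) (P.map V a) := by
  refine RingHom.congr_fun (f := (P.map U).comp (res h))
    (g := (res (f.preimage_mono h)).comp (P.map V))
    (ringHom_ext (fun r => ?_) fun u v φ => ?_) a
  · rw [RingHom.comp_apply, RingHom.comp_apply, res_algebraMap, map_algebraMap, map_algebraMap,
      res_algebraMap]
    exact congrArg _ (ConcreteCategory.congr_hom (f.naturality (homOfLE h).op) r)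
  · rw [RingHom.comp_apply, RingHom.comp_apply, res_gen, map_gen, map_gen, res_gen, P.e_res,
      P.e_res, P.d_res]

theorem map_evenWord {U : Y.Opens} (e : Fin 4 → Γ(E, U)) (φ : DualSections L U) (i : Fin 8) :
    P.map U (q.evenWord e φ i) = q'.evenWord (fun k => P.e U (e k)) (P.d U φ) i := by
  fin_cases i <;> simp [evenWord, map_gen]

/-- The composition of the maps on presheaves with the sheafification. -/
def mapSheafify : q.prePresheaf ⟶ (Opens.map f.base).op ⋙ q'.evenClifford.sheaf.obj where
  app U := RingCat.ofHom ((q'.toSections (f ⁻¹ᵁ U.unop)).comp (P.map U.unop))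
  naturality U V i := by
    ext a
    refine (congrArg (q'.toSections _) (P.map_res (leOfHom i.unop) a)).trans ?_
    exact (q'.res_toSections (f.preimage_mono (leOfHom i.unop)) _).symm

/-- Needed so that a map from the presheaf into the direct image extends over the sheafification. -/
theorem isSheaf_pushforward (B : AlgebraSheaf X) (f : X ⟶ Y) :
    Presheaf.IsSheaf (Opens.grothendieckTopology Y) ((Opens.map f.base).op ⋙ B.sheaf.obj) :=
  ((TopCat.Sheaf.pushforward RingCat.{u} f.base).obj B.sheaf).property

/-- The map on sections of the even Clifford algebras. -/
def appSections (U : Y.Opens) : q.evenClifford.Sections U →+* q'.evenClifford.Sections (f ⁻¹ᵁ U) :=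
  ((sheafifyLift (Opens.grothendieckTopology Y) P.mapSheafify
    (isSheaf_pushforward q'.evenClifford f)).app (op U)).hom

theorem appSections_toSections (U : Y.Opens) (a : q.PreSections U) :
    P.appSections U (q.toSections U a) = q'.toSections _ (P.map U a) :=
  ConcreteCategory.congr_hom (NatTrans.congr_app (toSheafify_sheafifyLift
    (Opens.grothendieckTopology Y) P.mapSheafify (isSheaf_pushforward q'.evenClifford f)) (op U)) a

/-- The morphism of even Clifford algebras induced by a map of quadratic forms. -/
def hom : NCScheme.Hom ⟨X, q'.evenClifford⟩ ⟨Y, q.evenClifford⟩ where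
  base := f
  app U := P.appSections U
  app_res h b := ConcreteCategory.congr_hom ((sheafifyLift (Opens.grothendieckTopology Y)
    P.mapSheafify (isSheaf_pushforward q'.evenClifford f)).naturality (homOfLE h).op) b
  app_algMap U r := by
    refine (congrArg (P.appSections U) (q.algMap_eq_toSections r)).trans ?_
    rw [P.appSections_toSections, map_algebraMap]
    rfl

end ModuleQuadraticForm.Pullback

/-! ### Restriction to a hyperplane and local bases -/

section

variable {ι : Type} [Fintype ι] {w : ι → ℕ}

/-- The map of quadratic forms given by restriction to a hyperplane. -/
def matrixPullback {M : Matrix ι ι (PolyRing (n + 1))}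
    (hM : ∀ k l, (M k l).IsHomogeneous (w k + w l + 1)) {M' : Matrix ι ι (PolyRing n)}
    (hM' : ∀ k l, (M' k l).IsHomogeneous (w k + w l + 1)) (h : ∀ k l, killLast n (M k l) = M' k l) :
    ModuleQuadraticForm.Pullback (hyperplaneInclusion n) (matrixForm w M hM)
      (matrixForm w M' hM') where
  e U := AddMonoidHom.mk' bundlePull bundlePull_add
  d U := AddMonoidHom.mk' dualPull dualPull_add
  e_smul r v := bundlePull_smul r v
  d_smul r φ := dualPull_smul r φ
  e_res h v := bundlePull_res h v
  d_res h φ := dualPull_res h φ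
  eval_form φ v := by
    refine Eq.trans ?_ (eval_dualPull φ _)
    exact congrArg _ (twistPull_matrixForm hM hM' h v).symm

/-- The basis of the even Clifford algebra on a chart. -/
def chartBasis (σ : Fin 4 ≃ ι) (q : ModuleQuadraticForm (splitBundle n w) (twist n 1))
    (j : Fin (n + 1)) {U : (PSpace n).Opens} (hU : U ≤ chart j) (i : Fin 8) :
    q.evenClifford.Sections U :=
  q.toSections U (q.evenWord (fun k => frame w j hU (σ k)) (dualGen j hU) i)

/-- Restricting the frame and the generator to a smaller open set gives the frame and generator
there, so the words are a basis of the presheaf over each open subset, as sheafification requires.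
-/
theorem isBasis_chartBasis (σ : Fin 4 ≃ ι)
    (q : ModuleQuadraticForm (splitBundle n w) (twist n 1)) (j : Fin (n + 1))
    {U : (PSpace n).Opens} (hU : U ≤ chart j) :
    q.evenClifford.IsBasis (chartBasis σ q j hU) := by
  refine q.isBasis_toSections _ fun V h => ?_
  obtain ⟨b, hb⟩ := exists_basis_frame w j (h.trans hU)
  have := q.evenWord_bijective (b.reindex σ.symm) (dualGen j (h.trans hU))
    (dualGen_bijective j (h.trans hU))
  convert this using 4 with c i
  rw [q.res_evenWord, dualGen_res]
  congr 1
  funext k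
  rw [frame_res, Module.Basis.reindex_apply, Equiv.symm_symm, hb]

theorem isLocallyFree_of_equiv (σ : Fin 4 ≃ ι)
    (q : ModuleQuadraticForm (splitBundle n w) (twist n 1)) :
    q.evenClifford.IsLocallyFreeOfFiniteRank := fun x => by
  obtain ⟨j, hj⟩ := exists_mem_chart x
  exact ⟨chart j, hj, 8, chartBasis σ q j le_rfl, isBasis_chartBasis σ q j le_rfl⟩

/-- The charts of the first `n + 1` coordinates already cover the hyperplane. On them `x_j^{-w}`
pulls back to `x_j^{-w}`, so the basis of words maps to the basis of words. -/
theorem hasLocalBases_matrixPullback (σ : Fin 4 ≃ ι) {M : Matrix ι ι (PolyRing (n + 1))}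
    (hM : ∀ k l, (M k l).IsHomogeneous (w k + w l + 1)) {M' : Matrix ι ι (PolyRing n)}
    (hM' : ∀ k l, (M' k l).IsHomogeneous (w k + w l + 1)) (h : ∀ k l, killLast n (M k l) = M' k l) :
    (matrixPullback hM hM' h).hom.HasLocalBases := fun x => by
  obtain ⟨j, hj⟩ := exists_mem_chart x
  have key : ∀ i, (matrixPullback hM hM' h).appSections _
      (chartBasis σ (matrixForm w M hM) j.castSucc le_rfl i) =
      chartBasis σ (matrixForm w M' hM') j (preimage_le_chart le_rfl) i := fun i => by
    refine ((matrixPullback hM hM' h).appSections_toSections _ _).trans (congrArg _ ?_)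
    rw [ModuleQuadraticForm.Pullback.map_evenWord]
    congr 1
    · funext k
      exact bundlePull_frame j _ _
    · exact dualPull_dualGen j _
  refine ⟨chart j.castSucc, mem_chart_castSucc.2 hj, 8, chartBasis σ _ j.castSucc le_rfl,
    isBasis_chartBasis σ _ j.castSucc le_rfl, ?_⟩
  have hb := isBasis_chartBasis σ (matrixForm w M' hM') j
    (preimage_le_chart (U := chart j.castSucc) le_rfl)
  rwa [← funext key] at hb

end

/-! ### Coefficients of a hyperplane section -/

/-- A quadratic polynomial with symmetric coefficients vanishing everywhere is zero. -/
theorem coefficients_eq_zero {R ι : Type*} [CommRing R] [IsDomain R] [CharZero R] [Fintype ι]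
    {A : ι → ι → R} {B : ι → R} {F : R} (hA : ∀ i j, A i j = A j i)
    (h : ∀ c : ι → R, (∑ i, ∑ j, A i j * (c i * c j)) + 2 * (∑ k, B k * c k) + F = 0) :
    (∀ i j, A i j = 0) ∧ (∀ k, B k = 0) ∧ F = 0 := by
  classical
  -- Values at `s e_i + t e_j` suffice: the origin gives `F`, the points `±e_i` give the diagonal
  -- entries and then `B`, and `e_i + e_j` gives the remaining entries.
  have key : ∀ i j (s t : R), s * s * A i i + s * t * A i j + t * s * A j i + t * t * A j j +
      2 * (s * B i + t * B j) + F = 0 := fun i j s t => by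
    have := h (Pi.single i s + Pi.single j t)
    simp only [Pi.add_apply, Pi.single_apply, mul_add, add_mul, Finset.sum_add_distrib, mul_ite,
      ite_mul, mul_zero, zero_mul, Finset.sum_ite_eq', Finset.mem_univ, if_true] at this
    linear_combination this
  have hF : F = 0 := by
    have := h 0
    simpa using this
  have hAii : ∀ i, A i i = 0 := fun i => by
    have : (2 : R) * A i i = 0 := by
      linear_combination key i i 1 0 + key i i (-1) 0 - 2 * hF
    exact (mul_eq_zero.1 this).resolve_left two_ne_zero
  have hB : ∀ k, B k = 0 := fun k => by
    have : (2 : R) * B k = 0 := by linear_combination key k k 1 0 - hAii k - hF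
    exact (mul_eq_zero.1 this).resolve_left two_ne_zero
  refine ⟨fun i j => ?_, hB, hF⟩
  have : (2 : R) * A i j = 0 := by
    linear_combination key i j 1 1 - hAii i - hAii j - 2 * hB i - 2 * hB j - hF + hA i j
  exact (mul_eq_zero.1 this).resolve_left two_ne_zero

namespace CubicData

variable {b a : ℕ}

theorem aeval_equation {n : ℕ} (D : CubicData b a) (g : Fin (b + 1) → PolyRing n)
    (c : Fin (a + 1) → PolyRing n) : MvPolynomial.aeval (R := ℂ) (Sum.elim g c) D.equation =
      (∑ i, ∑ j, MvPolynomial.aeval (R := ℂ) g (D.l i j) * (c i * c j)) +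
        2 * (∑ k, MvPolynomial.aeval (R := ℂ) g (D.q k) * c k) + MvPolynomial.aeval (R := ℂ) g D.f := by
  simp only [equation, map_add, map_mul, map_sum, MvPolynomial.aeval_rename, MvPolynomial.aeval_X,
    Sum.elim_inr, Sum.elim_comp_inl, map_ofNat]

theorem killLast_apply {n : ℕ} (p : PolyRing (n + 1)) : killLast n p = MvPolynomial.aeval (R := ℂ)
    (Fin.snoc (α := fun _ => PolyRing n) MvPolynomial.X 0 : Fin (n + 2) → PolyRing n) p := rfl

/-- The coefficients of a hyperplane section. -/
theorem killLast_matrix {Y : CubicData b a} {Y' : CubicData (b + 1) a}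
    {F' : MvPolynomial (Fin (b + 2) ⊕ Fin (a + 1)) ℂ}
    (h : Y'.equation = MvPolynomial.rename (Sum.map Fin.castSucc id) Y.equation +
      MvPolynomial.X (Sum.inl (Fin.last _)) * F') (k l : Fin (a + 1) ⊕ Unit) :
    killLast b (Y'.matrix k l) = Y.matrix k l := by
  -- Substituting 0 for the last `x` removes the multiple of it. With arbitrary polynomials `c` in
  -- place of the `y` variables, the equation says that the difference of the two quadratic
  -- polynomials vanishes at every `c`.
  have hc := coefficients_eq_zero (A := fun i j => killLast b (Y'.l i j) - Y.l i j)
    (B := fun k => killLast b (Y'.q k) - Y.q k) (F := killLast b Y'.f - Y.f)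
    (fun i j => by rw [Y.l_symm, Y'.l_symm]) fun c => by
      have h' := congrArg (MvPolynomial.aeval (R := ℂ) (Sum.elim (Fin.snoc
        (α := fun _ => PolyRing b) MvPolynomial.X 0 : Fin (b + 2) → PolyRing b) c)) h
      rw [map_add, map_mul, MvPolynomial.aeval_X, MvPolynomial.aeval_rename, aeval_equation,
        Sum.elim_inl, Fin.snoc_last, zero_mul, add_zero, Sum.elim_comp_map, Function.comp_id,
        show (Fin.snoc (α := fun _ => PolyRing b) MvPolynomial.X 0 : Fin (b + 2) → PolyRing b) ∘
          Fin.castSucc = MvPolynomial.X from funext fun j => Fin.snoc_castSucc _ _ _,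
        aeval_equation] at h'
      simp only [MvPolynomial.aeval_X_left_apply, ← killLast_apply] at h'
      simp only [sub_mul, Finset.sum_sub_distrib]
      linear_combination h'
  obtain ⟨hl, hq, hf⟩ := hc
  rcases k with k | k <;> rcases l with l | l
  exacts [sub_eq_zero.1 (hl k l), sub_eq_zero.1 (hq k), sub_eq_zero.1 (hq l), sub_eq_zero.1 hf]

end CubicData

end

theorem mainTheorem6
    (Y : CubicData 2 2) (Y' : CubicData 3 2)
    (F' : MvPolynomial (Fin 4 ⊕ Fin 3) ℂ) (hF' : F'.IsHomogeneous 2)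
    (hY' : Y'.equation = MvPolynomial.rename (Sum.map Fin.castSucc id) Y.equation +
      MvPolynomial.X (Sum.inl 3) * F') :
    Y.ncSpace.alg.IsLocallyFreeOfFiniteRank ∧
    Y'.ncSpace.alg.IsLocallyFreeOfFiniteRank ∧
    ∃ p : Y.ncSpace ⟶ Y'.ncSpace,
      NCScheme.Hom.base p = hyperplaneInclusion 2 ∧
      NCScheme.IsStrict p ∧
      IsPullback p Y.ncSpace.toBase Y'.ncSpace.toBase
        (NCScheme.ofHom (hyperplaneInclusion 2)) := by
  -- Any ordering of the four summands serves, provided the same one is used on both spaces.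
  let σ : Fin 4 ≃ Fin 3 ⊕ Unit := Fintype.equivOfCardEq (by simp)
  have hp := hasLocalBases_matrixPullback σ Y'.matrix_homogeneous Y.matrix_homogeneous
    (CubicData.killLast_matrix hY')
  exact ⟨isLocallyFree_of_equiv σ Y.quadraticForm, isLocallyFree_of_equiv σ Y'.quadraticForm,
    _, rfl, NCScheme.Hom.HasLocalBases.isStrict hp, NCScheme.Hom.HasLocalBases.isPullback hp⟩
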